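/- Bivariate LR meshes and LR B-splines. Let $\Omega=[a_1,b_1]\times[a_2,b_2]$ be a non-degenerate rectangle and $\mathbf p=(p_1,p_2)$ a bidegree. An \emph{open tensor-product mesh} is given by two global knot vectors on $[a_k,b_k]$, $k=1,2$, whose boundary knots have multiplicity $p_k+1$ and whose internal knots have multiplicity between $1$ and $p_k+1$; its B-splines are the tensor-product B-splines with $p_k+2$ consecutive knots in each direction. A B-spline $B$ has \emph{minimal support} on a mesh if no value $c$ in the interior of one of its coordinate support intervals is such that, all across $\operatorname{supp} B$, the mesh contains the line at $c$ with a multiplicity larger than that of $c$ in the local knot vector of $B$. An \emph{LR mesh} of bidegree $\mathbf p$ is a mesh obtained from an open tensor-product mesh by finitely many steps, each of which either inserts a new meshline (possibly extending existing ones, with endpoints on orthogonal meshlines) so that the support of at least one current LR B-spline is traversed, or increases the multiplicity of an existing meshline to at most $p_k+1$. After each step, B-splines without minimal support are replaced, by recursive knot insertion, until all B-splines have minimal support; the result is the collection of \emph{LR B-splines} of the new mesh. A collection of B-splines is \emph{locally linearly independent} if, on every open subset $U$ of $\Omega$, those of its members that do not vanish identically on $U$ are linearly independent on $U$. For $s\in\mathbb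 N=\{0,1,\dots\}$ and $p=2s+1$, an LR mesh of bidegree $(p,p)$ is called \emph{admissible for RM B-splines of degree $(p,p)$} if every internal meshline has multiplicity $s+1$, every boundary meshline has multiplicity $2s+2=p+1$, and the LR B-splines of bidegree $(p,p)$ on it are locally linearly independent. \textbf{Corollary.} Let $s,s'\in\mathbb N$, $p=2s+1$, $p'=2s'+1$. If an LR mesh $\mathcal M$ is admissible for RM B-splines of degree $(p,p)$, then the mesh with the same meshlines as $\mathcal M$, in which the multiplicity of the internal meshlines is changed from $s+1$ to $s'+1$ and that of the boundary meshlines from $2s+2=p+1$ to $2s'+2=p'+1$, is admissible for RM B-splines of degree $(p',p')$; in particular it is an LR mesh of bidegree $(p',p')$. -/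

import Mathlib

/-! # LR meshes, LR B-splines and admissibility for RM B-splines (bivariate case)

Directions are indexed by `k : Fin 2`; the other direction is `1 - k`.  A line "of direction `k`"
is a line on which the `k`-th coordinate is constant (`k = 0`: vertical, `k = 1`: horizontal). -/

noncomputable section

namespace LRSpline

/-! ### Univariate B-splines -/

/-- First knot of a (sorted) knot vector. -/
def firstKnot (L : List ℝ) : ℝ := L.headD 0

/-- Last knot of a (sorted) knot vector. -/
def lastKnot (L : List ℝ) : ℝ := L.getLastD 0

/-- The univariate B-spline of degree `p` on a local knot vector with `p + 2` knots, by the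
Cox--de Boor recursion (with the usual convention that a quotient with denominator `0` is `0`).
`L.dropLast` and `L.tail` are the first and the last `p + 1` of the `p + 2` knots. -/
def bspline : ℕ → List ℝ → ℝ → ℝ
  | 0, L, x => if firstKnot L ≤ x ∧ x < lastKnot L then 1 else 0
  | p + 1, L, x =>
      (x - firstKnot L) / (lastKnot L.dropLast - firstKnot L) * bspline p L.dropLast x +
      (lastKnot L - x) / (lastKnot L - firstKnot L.tail) * bspline p L.tail x

/-! ### Tensor-product B-splines given by their local knot vectors -/

/-- The two local knot vectors of a bivariate B-spline.  A B-spline is identified with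
its pair of local knot vectors. -/
abbrev LocalKnots : Type := Fin 2 → List ℝ

/-- The bivariate B-spline of bidegree `p` with local knot vectors `B`. -/
def LocalKnots.eval (p : Fin 2 → ℕ) (B : LocalKnots) (z : Fin 2 → ℝ) : ℝ :=
  ∏ k, bspline (p k) (B k) (z k)

/-- The support of the B-spline, projected to the `k`-th coordinate axis. -/
def LocalKnots.supp (B : LocalKnots) (k : Fin 2) : Set ℝ :=
  Set.Icc (firstKnot (B k)) (lastKnot (B k))

/-! ### Meshes with multiplicities -/

/-- A mesh with multiplicities on the rectangle `[lo 0, hi 0] × [lo 1, hi 1]`.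
`mult k c t` is the multiplicity of the mesh, as a line of direction `k`, at the point whose
`k`-th coordinate is `c` and whose other coordinate is `t`; it is `0` if no meshline
of direction `k` passes through this point.  Meshlines are closed segments, and where two
collinear ones meet in an endpoint, `mult` is the larger of the two multiplicities. -/
@[ext] structure Mesh where
  lo : Fin 2 → ℝ
  hi : Fin 2 → ℝ
  lo_lt_hi : ∀ k, lo k < hi k
  mult : Fin 2 → ℝ → ℝ → ℕ

/-- The domain of the mesh, a closed rectangle. -/
def Mesh.domain (M : Mesh) : Set (Fin 2 → ℝ) := {z | ∀ k, z k ∈ Set.Icc (M.lo k) (M.hi k)}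

/-- Along the segment of direction `k` with `k`-th coordinate `c` and other coordinate in `[u, v]`,
bring the multiplicity to at least `m`. -/
def Mesh.raise (M : Mesh) (k : Fin 2) (c u v : ℝ) (m : ℕ) : Mesh where
  lo := M.lo
  hi := M.hi
  lo_lt_hi := M.lo_lt_hi
  mult := fun k' c' t =>
    if k' = k ∧ c' = c ∧ t ∈ Set.Icc u v then max (M.mult k' c' t) m else M.mult k' c' t

/-- The segment of direction `k` with `k`-th coordinate `c` and other coordinate in `[u, v]` is
non-degenerate, not on the boundary, and both its endpoints lie on meshlines
of the other direction (so that it cuts rectangular cells into rectangular cells). -/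
def Mesh.IsInternalSegment (M : Mesh) (k : Fin 2) (c u v : ℝ) : Prop :=
  c ∈ Set.Ioo (M.lo k) (M.hi k) ∧ u < v ∧
    u ∈ Set.Icc (M.lo (1 - k)) (M.hi (1 - k)) ∧ v ∈ Set.Icc (M.lo (1 - k)) (M.hi (1 - k)) ∧
    0 < M.mult (1 - k) u c ∧ 0 < M.mult (1 - k) v c

/-- The mesh obtained by keeping all meshlines and giving multiplicity `mi` to the internal
ones and multiplicity `mb` to the boundary ones. -/
def Mesh.setMult (M : Mesh) (mi mb : ℕ) : Mesh where
  lo := M.lo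
  hi := M.hi
  lo_lt_hi := M.lo_lt_hi
  mult := fun k c t =>
    if M.mult k c t = 0 then 0 else if c = M.lo k ∨ c = M.hi k then mb else mi

/-! ### Minimal support and knot insertion -/

/-- The meshlines of `M` of direction `k` at the value `c` traverse the support of `B` without
being (with this multiplicity) part of the local tensor mesh of `B`: `c` is interior
to the support in direction `k`, and all along the support in the other direction the
multiplicity in `M` exceeds the multiplicity of `c` in the local knot vector. -/
def Traverses (M : Mesh) (B : LocalKnots) (k : Fin 2) (c : ℝ) : Prop :=
  firstKnot (B k) < c ∧ c < lastKnot (B k) ∧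
    ∀ t ∈ B.supp (1 - k), (B k).count c < M.mult k c t

/-- `B` has minimal support on `M`. -/
def MinimalSupport (M : Mesh) (B : LocalKnots) : Prop := ∀ k c, ¬ Traverses M B k c

/-- `B'` is one of the two B-splines that replace `B` when a missing knot, coming from a
traversing meshline of `M`, is inserted in one of its local knot vectors: its new
knot vector consists of the first, or of the last, `p + 2` of the `p + 3` extended knots. -/
def SplitsTo (M : Mesh) (B B' : LocalKnots) : Prop :=
  ∃ k c, Traverses M B k c ∧
    (B' = Function.update B k ((B k).orderedInsert (· ≤ ·) c).dropLast ∨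
     B' = Function.update B k ((B k).orderedInsert (· ≤ ·) c).tail)

/-- The B-splines obtained from the collection `S` by recursively applying knot insertion until
all resulting B-splines have minimal support on `M`.  (Different orders of
insertion end in the same B-splines.) -/
def refine (M : Mesh) (S : Set LocalKnots) : Set LocalKnots :=
  {B' | MinimalSupport M B' ∧ ∃ B ∈ S, Relation.ReflTransGen (SplitsTo M) B B'}

/-! ### Open tensor-product meshes -/

/-- `L` is a global knot vector on `[a, b]` for degree `p` with all multiplicities at most `p + 1`,
and open: the boundary knots have multiplicity `p + 1`. -/
def IsOpenKnotVector (p : ℕ) (a b : ℝ) (L : List ℝ) : Prop :=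
  L.Pairwise (· ≤ ·) ∧ (∀ c ∈ L, c ∈ Set.Icc a b) ∧ L.count a = p + 1 ∧ L.count b = p + 1 ∧
    ∀ c, L.count c ≤ p + 1

/-- The tensor-product mesh given by two global knot vectors. -/
def tensorMesh (lo hi : Fin 2 → ℝ) (h : ∀ k, lo k < hi k) (Ξ : Fin 2 → List ℝ) : Mesh where
  lo := lo
  hi := hi
  lo_lt_hi := h
  mult := fun k c t =>
    if t ∈ Set.Icc (lo (1 - k)) (hi (1 - k)) then (Ξ k).count c else 0

/-- The tensor-product B-splines of bidegree `p`: the local knot vector in direction `k` consists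
of `p k + 2` consecutive knots of the global knot vector. -/
def tensorBSplines (p : Fin 2 → ℕ) (Ξ : Fin 2 → List ℝ) : Set LocalKnots :=
  {B | ∀ k, B k <:+: Ξ k ∧ (B k).length = p k + 2}

/-! ### LR meshes and LR B-splines -/

/-- `IsLR p M S`: `M` is an LR mesh for the bidegree `p`, and `S` is its collection of LR B-splines.

The construction starts from an open tensor-product mesh and its tensor-product B-splines. Each
further step inserts a new meshline (or extends existing ones) so that the support
of at least one LR B-spline becomes traversed, or increases the multiplicity of an
existing meshline up to at most `p k + 1`.  New meshlines come with multiplicity one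
and can be given a higher multiplicity by the second kind of step. -/
inductive IsLR (p : Fin 2 → ℕ) : Mesh → Set LocalKnots → Prop
  | tensor (lo hi : Fin 2 → ℝ) (h : ∀ k, lo k < hi k) (Ξ : Fin 2 → List ℝ)
      (hΞ : ∀ k, IsOpenKnotVector (p k) (lo k) (hi k) (Ξ k)) :
      IsLR p (tensorMesh lo hi h Ξ) (tensorBSplines p Ξ)
  | insert (M : Mesh) (S : Set LocalKnots) (hM : IsLR p M S) (k : Fin 2) (c u v : ℝ)
      (hseg : M.IsInternalSegment k c u v)
      (htrav : ∃ B ∈ S, Traverses (M.raise k c u v 1) B k c) :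
      IsLR p (M.raise k c u v 1) (refine (M.raise k c u v 1) S)
  | increase (M : Mesh) (S : Set LocalKnots) (hM : IsLR p M S) (k : Fin 2) (c u v : ℝ)
      (hseg : M.IsInternalSegment k c u v) (hexist : ∀ t ∈ Set.Icc u v, 0 < M.mult k c t)
      (m : ℕ) (hm : m ≤ p k + 1) :
      IsLR p (M.raise k c u v m) (refine (M.raise k c u v m) S)

/-- Local linear independence of a collection of B-splines of bidegree `p` on a domain `Ω`: on every
open subset `U` of `Ω`, the B-splines that do not vanish identically on `U` have linearly
independent restrictions to `U`. -/
def LocallyLinearIndependent (p : Fin 2 → ℕ) (Ω : Set (Fin 2 → ℝ)) (S : Set LocalKnots) : Prop :=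
  ∀ U : Set (Fin 2 → ℝ), IsOpen U → U ⊆ Ω →
    LinearIndependent ℝ
      (fun B : {B : LocalKnots // B ∈ S ∧ ∃ z ∈ U, B.eval p z ≠ 0} =>
        U.domRestrict (B.1.eval p))

/-- `M` is an LR mesh admissible for RM B-splines of bidegree `(2s+1, 2s+1)`: it is an LR mesh
for this bidegree, internal meshlines have multiplicity `s + 1`, boundary meshlines have
multiplicity `2s + 2`, and the LR B-splines on it are locally linearly independent.
(The LR B-splines do not depend on how the mesh was constructed; the last clause is
stated for every construction of the mesh.) -/
structure AdmissibleRM (s : ℕ) (M : Mesh) : Prop where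
  isLR : ∃ S, IsLR (fun _ => 2 * s + 1) M S
  internal : ∀ k, ∀ c ∈ Set.Ioo (M.lo k) (M.hi k), ∀ t,
    M.mult k c t ≠ 0 → M.mult k c t = s + 1
  boundary : ∀ k, ∀ c, c = M.lo k ∨ c = M.hi k →
    ∀ t ∈ Set.Icc (M.lo (1 - k)) (M.hi (1 - k)), M.mult k c t = 2 * s + 2
  locallyLinearIndependent : ∀ S, IsLR (fun _ => 2 * s + 1) M S →
    LocallyLinearIndependent (fun _ => 2 * s + 1) M.domain S

end LRSpline

end

noncomputable section

namespace LRSpline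

/-! ### Sorted lists and their windows -/

/-! Everything reduces to a bilinear situation that does not see `s`. Keep the meshlines, give them
multiplicity 1 inside and 2 on the boundary, and refine the bilinear Bernstein basis along them.
Repeating each knot `s + 1` times turns a local knot triple into `3s + 3` knots, which have `s + 1`
windows of `2s + 3` knots. So a bilinear B-spline `P` yields a group (`Grp`) of `(s + 1) ^ 2`
B-splines of bidegree `(2s + 1, 2s + 1)` with the same support. Inserting `s + 1` copies of a knot
acts on groups as inserting one copy acts on `P`. Hence (`mem_refine_iff_grp`) the LR B-splines for
multiplicity `s + 1` are the members of the groups of a set of bilinear B-splines that is the same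
for every `s`.

This needs the LR B-splines to be a function of the mesh. Knot insertions along traversing lines can
be reordered (`exists_window_reach`), the process terminates (`room_lt`), and so the LR B-splines
are the refinement of the Bernstein basis along the final mesh (`IsLR.eq_refine`).

The new mesh is an LR mesh because the construction can be replayed (`IsLR.setMult`): steps that
only raise a multiplicity are dropped, and a new line is inserted with multiplicity one and raised
to `s' + 1` at once. The support traversed in the old construction leads to one in the new
construction through the common bilinear B-spline (`exists_traverses_setMult`).

Local linear independence is a dimension count on boxes without knots, where a B-spline either
vanishes or is a polynomial without zeros. Suppose `N` bilinear B-splines cover such a box. They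
give `N (s + 1) ^ 2` B-splines in a polynomial space of dimension `4 (s + 1) ^ 2`, so independence
forces `N ≤ 4` (`card_covers_le`). Conversely, by `bspline_knot_insertion` the refined B-splines
still span the Bernstein polynomials, which have rank `4 (s' + 1) ^ 2` on the box; if `N ≤ 4`, there
are no more B-splines than that, so they are independent (`linearIndependent_on_box`). The condition
`N ≤ 4` does not involve the degree. -/

/-- Insertion of a knot in a sorted knot vector. -/
abbrev ins (c : ℝ) (L : List ℝ) : List ℝ := L.orderedInsert (· ≤ ·) c

/-- `L` is sorted. -/
abbrev Srt (L : List ℝ) : Prop := L.Pairwise (· ≤ ·)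

theorem firstKnot_cons (a : ℝ) (L : List ℝ) : firstKnot (a :: L) = a := rfl

theorem lastKnot_append_singleton (a : ℝ) (L : List ℝ) : lastKnot (L ++ [a]) = a := by
  simp [lastKnot]

theorem firstKnot_mem {L : List ℝ} (h : L ≠ []) : firstKnot L ∈ L := by
  cases L with
  | nil => exact absurd rfl h
  | cons a l => simp [firstKnot]

theorem lastKnot_mem {L : List ℝ} (h : L ≠ []) : lastKnot L ∈ L := by
  rcases List.eq_nil_or_concat L with rfl | ⟨l, a, rfl⟩
  · exact absurd rfl h
  · simp [lastKnot]

theorem firstKnot_append {L L' : List ℝ} (h : L ≠ []) : firstKnot (L ++ L') = firstKnot L := by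
  cases L with
  | nil => exact absurd rfl h
  | cons a l => rfl

theorem lastKnot_append {L L' : List ℝ} (h : L' ≠ []) : lastKnot (L ++ L') = lastKnot L' := by
  rcases List.eq_nil_or_concat L' with rfl | ⟨l, a, rfl⟩
  · exact absurd rfl h
  · rw [List.concat_eq_append, ← List.append_assoc, lastKnot_append_singleton,
      lastKnot_append_singleton]

theorem firstKnot_le {L : List ℝ} (h : Srt L) {x : ℝ} (hx : x ∈ L) : firstKnot L ≤ x := by
  cases L with
  | nil => simp at hx
  | cons a l =>
    rcases List.mem_cons.1 hx with rfl | hx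
    · exact le_rfl
    · exact List.rel_of_pairwise_cons h hx

theorem le_lastKnot {L : List ℝ} (h : Srt L) {x : ℝ} (hx : x ∈ L) : x ≤ lastKnot L := by
  rcases List.eq_nil_or_concat L with rfl | ⟨l, a, rfl⟩
  · simp at hx
  · rw [List.concat_eq_append] at *
    rw [lastKnot_append_singleton]
    rcases List.mem_append.1 hx with hx | hx
    · exact (List.pairwise_append.1 h).2.2 x hx a (by simp)
    · simp at hx; exact hx.le

theorem Srt.eq_of_perm {L L' : List ℝ} (h : Srt L) (h' : Srt L') (hp : L.Perm L') : L = L' :=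
  List.Perm.eq_of_pairwise' h h' hp

theorem Srt.ins {L : List ℝ} (h : Srt L) (c : ℝ) : Srt (ins c L) :=
  List.Pairwise.orderedInsert c L h

theorem Srt.infix {L L' : List ℝ} (h : Srt L) (h' : L' <:+: L) : Srt L' :=
  List.Pairwise.sublist h'.sublist h

theorem length_ins (c : ℝ) (L : List ℝ) : (ins c L).length = L.length + 1 :=
  List.orderedInsert_length _ _ _

theorem mem_ins {a c : ℝ} {L : List ℝ} : a ∈ ins c L ↔ a = c ∨ a ∈ L :=
  List.mem_orderedInsert _

theorem count_ins (a c : ℝ) (L : List ℝ) :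
    (ins c L).count a = L.count a + if c = a then 1 else 0 :=
  List.orderedInsert_count _ _ _ _

theorem count_ins_of_ne {a c : ℝ} (h : a ≠ c) (L : List ℝ) : (ins c L).count a = L.count a := by
  rw [count_ins, if_neg (Ne.symm h), add_zero]

theorem perm_ins (c : ℝ) (L : List ℝ) : (ins c L).Perm (c :: L) :=
  List.perm_orderedInsert _ _ _

theorem ins_comm {L : List ℝ} (h : Srt L) (c d : ℝ) : ins c (ins d L) = ins d (ins c L) := by
  refine ((h.ins d).ins c).eq_of_perm ((h.ins c).ins d) ?_
  exact (perm_ins _ _).trans (((perm_ins _ _).cons _).trans ((List.Perm.swap _ _ _).trans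
    (((perm_ins _ _).symm.cons _).trans (perm_ins _ _).symm)))

theorem ins_append {A D : List ℝ} (h : Srt (A ++ D)) {c : ℝ} (hA : ∀ a ∈ A, a ≤ c)
    (hD : ∀ d ∈ D, c ≤ d) : ins c (A ++ D) = A ++ c :: D := by
  refine (h.ins c).eq_of_perm ?_ ((perm_ins _ _).trans List.perm_middle.symm)
  rw [Srt, List.pairwise_append] at h ⊢
  refine ⟨h.1, List.pairwise_cons.2 ⟨hD, h.2.1⟩, fun a ha b hb => ?_⟩
  rcases List.mem_cons.1 hb with rfl | hb
  · exact hA a ha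
  · exact h.2.2 a ha b hb

/-- As `c` lies between the end knots of the window, its sorted position can be taken inside the
window, and the knots before and after are untouched. -/
theorem ins_infix_ins {V L : List ℝ} (h : Srt L) (hV : V <:+: L) (hne : V ≠ []) {c : ℝ}
    (h1 : firstKnot V ≤ c) (h2 : c ≤ lastKnot V) : ins c V <:+: ins c L := by
  obtain ⟨X, Y, rfl⟩ := hV
  have hV : Srt V := h.infix ⟨X, Y, rfl⟩
  have key : ins c (X ++ V ++ Y) = X ++ ins c V ++ Y := by
    refine (h.ins c).eq_of_perm ?_ ?_
    · rw [Srt, List.append_assoc, List.pairwise_append, List.pairwise_append] at h ⊢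
      obtain ⟨hX, ⟨hV, hY, hVY⟩, hXVY⟩ := h
      refine ⟨hX, ⟨Srt.ins hV c, hY, ?_⟩, ?_⟩
      · intro a ha b hb
        rcases mem_ins.1 ha with rfl | ha
        · exact h2.trans (hVY _ (lastKnot_mem hne) b hb)
        · exact hVY a ha b hb
      · intro a ha b hb
        rcases List.mem_append.1 hb with hb | hb
        · rcases mem_ins.1 hb with rfl | hb
          · exact le_trans (hXVY a ha _ (List.mem_append_left _ (firstKnot_mem hne))) h1
          · exact hXVY a ha b (List.mem_append_left _ hb)
        · exact hXVY a ha b (List.mem_append_right _ hb)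
    · refine (perm_ins _ _).trans ?_
      refine List.Perm.trans ?_ (((perm_ins c V).append_left X).append_right Y).symm
      simpa using (List.perm_middle (a := c) (l₁ := X) (l₂ := V ++ Y)).symm
  exact ⟨X, Y, key.symm⟩

theorem infix_ins_of_le_first {V L : List ℝ} (h : Srt L) (hV : V <:+: L) (hne : V ≠ []) {c : ℝ}
    (h1 : c ≤ firstKnot V) : V <:+: ins c L := by
  obtain ⟨X, Y, rfl⟩ := hV
  have key : ins c (X ++ V ++ Y) = ins c X ++ V ++ Y := by
    refine (h.ins c).eq_of_perm ?_ ?_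
    · rw [Srt, List.append_assoc, List.pairwise_append] at h ⊢
      obtain ⟨hX, hVY, hXVY⟩ := h
      refine ⟨Srt.ins hX c, hVY, ?_⟩
      intro a ha b hb
      rcases mem_ins.1 ha with rfl | ha
      · refine h1.trans (firstKnot_append (L' := Y) hne ▸ firstKnot_le hVY hb)
      · exact hXVY a ha b hb
    · refine (perm_ins _ _).trans ?_
      exact (((perm_ins c X).append_right V).append_right Y).symm
  exact ⟨_, _, key.symm⟩

theorem infix_ins_of_last_le {V L : List ℝ} (h : Srt L) (hV : V <:+: L) (hne : V ≠ []) {c : ℝ}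
    (h1 : lastKnot V ≤ c) : V <:+: ins c L := by
  obtain ⟨X, Y, rfl⟩ := hV
  have key : ins c (X ++ V ++ Y) = X ++ V ++ ins c Y := by
    refine (h.ins c).eq_of_perm ?_ ?_
    · rw [Srt, List.pairwise_append] at h ⊢
      obtain ⟨hXV, hY, hXVY⟩ := h
      refine ⟨hXV, Srt.ins hY c, ?_⟩
      intro a ha b hb
      rcases mem_ins.1 hb with rfl | hb
      · exact le_trans (lastKnot_append (L := X) hne ▸ le_lastKnot hXV ha) h1
      · exact hXVY a ha b hb
    · refine (perm_ins _ _).trans ?_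
      exact List.perm_middle.symm.trans ((perm_ins c Y).append_left _).symm
  exact ⟨_, _, key.symm⟩

theorem Srt.decompose {L : List ℝ} (h : Srt L) (c : ℝ) :
    ∃ A D, L = A ++ (List.replicate (L.count c) c ++ D) ∧ (∀ a ∈ A, a < c) ∧ ∀ d ∈ D, c < d := by
  refine ⟨L.filter (· < c), L.filter (c < ·), ?_, by simp, by simp⟩
  refine h.eq_of_perm ?_ ?_
  · rw [Srt, List.pairwise_append, List.pairwise_append]
    refine ⟨h.filter _, ⟨?_, h.filter _, ?_⟩, ?_⟩
    · simp [List.pairwise_replicate]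
    · intro a ha b hb
      rw [List.eq_of_mem_replicate ha]
      simp at hb; exact hb.2.le
    · intro a ha b hb
      simp at ha
      rcases List.mem_append.1 hb with hb | hb
      · rw [List.eq_of_mem_replicate hb]; exact ha.2.le
      · simp at hb; exact (ha.2.trans hb.2).le
  · rw [List.perm_iff_count]
    intro a
    rw [List.count_append, List.count_append, List.count_replicate]
    rcases lt_trichotomy a c with hac | rfl | hac
    · rw [List.count_eq_zero_of_not_mem (a := a) (l := L.filter (c < ·)) (by simp [hac.le]),
        List.count_filter (by simpa using hac)]
      simp [hac.ne']
    · rw [List.count_eq_zero_of_not_mem (a := a) (l := L.filter (a < ·)) (by simp),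
        List.count_eq_zero_of_not_mem (a := a) (l := L.filter (· < a)) (by simp)]
      simp
    · rw [List.count_eq_zero_of_not_mem (a := a) (l := L.filter (· < c)) (by simp [hac.le]),
        List.count_filter (by simpa using hac)]
      simp [hac.ne]

/-- Every window of a knot vector extended by `c` is a window of the original knot vector or
comes from inserting `c` in a window of it that has `c` in its interior. -/
theorem window_of_ins {L W : List ℝ} {c : ℝ} (h : Srt L) (hlt : ∃ x ∈ L, x < c)
    (hgt : ∃ x ∈ L, c < x) (hc : L.count c + 1 < W.length) (hW : W <:+: ins c L)
    (hlen : W.length ≤ L.length) :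
    W <:+: L ∨ ∃ V, V <:+: L ∧ V.length = W.length ∧ firstKnot V < c ∧ c < lastKnot V ∧
      W <:+: ins c V := by
  obtain ⟨A, D, hL, hA, hD⟩ := h.decompose c
  set m := L.count c with hm
  have hins : ins c L = A ++ (List.replicate (m + 1) c ++ D) := by
    have h' := h
    rw [hL] at h'
    conv_lhs => rw [hL]
    rw [ins_append h' (fun a ha => (hA a ha).le)]
    · simp [List.replicate_succ]
    · intro d hd
      rcases List.mem_append.1 hd with hd | hd
      · rw [List.eq_of_mem_replicate hd]
      · exact (hD d hd).le
  rw [hins] at hW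
  obtain ⟨X, Y, hXY⟩ := hW
  -- The main case: `W` contains all `m + 1` copies of `c`, with `A'` to the left and `D'` to the
  -- right of them. Then `V` is `W` with one copy of `c` traded for the neighbouring knot before or
  -- after `W`.
  have hmid : ∀ A' D', A = X ++ A' → D = D' ++ Y →
      W = A' ++ (List.replicate (m + 1) c ++ D') →
      ∃ V, V <:+: L ∧ V.length = W.length ∧ firstKnot V < c ∧ c < lastKnot V ∧
      W <:+: ins c V := by
    intro A' D' hA' hD' hW'
    have hinsV : ∀ A0 D0 : List ℝ, A0 ++ (List.replicate m c ++ D0) <:+: L →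
        (∀ a ∈ A0, a < c) → (∀ d ∈ D0, c < d) →
        ins c (A0 ++ (List.replicate m c ++ D0)) = A0 ++ (List.replicate (m + 1) c ++ D0) := by
      intro A0 D0 hi hA0 hD0
      rw [ins_append (h.infix hi) (fun a ha => (hA0 a ha).le)]
      · simp [List.replicate_succ]
      · intro d hd
        rcases List.mem_append.1 hd with hd | hd
        · rw [List.eq_of_mem_replicate hd]
        · exact (hD0 d hd).le
    -- Take the knot before `W` if there is none after it, or if `W` starts with `c` and needs a
    -- smaller first knot; otherwise take the one after it.
    by_cases hcase : Y = [] ∨ A' = []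
    · have hD'ne : D' ≠ [] := by
        rintro rfl
        rcases hcase with rfl | rfl
        · obtain ⟨x, hx, hcx⟩ := hgt
          rw [hL, hD'] at hx
          simp at hx
          rcases hx with hx | hx
          · exact lt_asymm (hA x hx) hcx
          · exact hcx.ne' hx.2
        · rw [hW'] at hc
          simp at hc
      have hXne : X ≠ [] := by
        rintro rfl
        rcases hcase with rfl | rfl
        · have h1 := congrArg List.length hL
          have h2 := congrArg List.length hW'
          rw [hA', hD'] at h1
          simp at h1 h2
          omega
        · obtain ⟨x, hx, hcx⟩ := hlt
          rw [hL, hA'] at hx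
          simp at hx
          rcases hx with hx | hx
          · exact hcx.ne hx.2
          · exact lt_asymm (hD x hx) hcx
      rcases List.eq_nil_or_concat X with rfl | ⟨X0, x, rfl⟩
      · exact absurd rfl hXne
      rw [List.concat_eq_append] at *
      have hi : (x :: A') ++ (List.replicate m c ++ D') <:+: L :=
        ⟨X0, Y, by rw [hL, hA', hD']; simp⟩
      refine ⟨_, hi, ?_, ?_, ?_, ?_⟩
      · rw [hW']; simp; omega
      · exact hA x (by rw [hA']; simp)
      · rw [lastKnot_append (by simp [hD'ne]), lastKnot_append hD'ne]
        exact hD _ (by rw [hD']; exact List.mem_append_left _ (lastKnot_mem hD'ne))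
      · rw [hinsV _ _ hi]
        · exact ⟨[x], [], by rw [hW']; simp⟩
        · intro a ha
          apply hA
          rw [hA']
          simp at ha ⊢
          tauto
        · intro d hd
          apply hD
          rw [hD']
          simp [hd]
    · push Not at hcase
      obtain ⟨hY, hA'ne⟩ := hcase
      obtain ⟨y, Y0, rfl⟩ := List.exists_cons_of_ne_nil hY
      have hi : A' ++ (List.replicate m c ++ (D' ++ [y])) <:+: L :=
        ⟨X, Y0, by rw [hL, hA', hD']; simp⟩
      refine ⟨_, hi, ?_, ?_, ?_, ?_⟩
      · rw [hW']; simp; omega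
      · rw [firstKnot_append hA'ne]
        exact hA _ (by rw [hA']; exact List.mem_append_right _ (firstKnot_mem hA'ne))
      · rw [← List.append_assoc, ← List.append_assoc, lastKnot_append_singleton]
        exact hD _ (by rw [hD']; simp)
      · rw [hinsV _ _ hi]
        · exact ⟨[], [y], by rw [hW']; simp⟩
        · intro a ha
          apply hA
          rw [hA']
          simp [ha]
        · intro d hd
          apply hD
          rw [hD']
          simp at hd ⊢
          tauto
  -- The window starts no later than the block of copies of `c`. If it stops before the last copy,
  -- that copy can be deleted behind it; otherwise `hmid` applies.
  have hleft : ∀ A', A = X ++ A' → W ++ Y = A' ++ (List.replicate (m + 1) c ++ D) →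
      W <:+: L ∨ ∃ V, V <:+: L ∧ V.length = W.length ∧ firstKnot V < c ∧ c < lastKnot V ∧
      W <:+: ins c V := by
    intro A' hA' hWY
    rw [← List.append_assoc, List.append_eq_append_iff] at hWY
    rcases hWY with ⟨E, h1, h2⟩ | ⟨E, h1, h2⟩
    · rcases List.eq_nil_or_concat E with rfl | ⟨E', e, rfl⟩
      · exact Or.inr (hmid A' [] hA' (by simpa using h2.symm) (by simpa using h1.symm))
      · left
        rw [List.replicate_succ', List.concat_eq_append, ← List.append_assoc,
          ← List.append_assoc] at h1
        have h3 := (List.append_inj' h1 rfl).1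
        refine ⟨X, E' ++ D, ?_⟩
        conv_rhs => rw [hL, hA']
        simp only [List.append_assoc] at h3 ⊢
        rw [← List.append_assoc W, ← h3]
        simp
    · exact Or.inr (hmid A' E hA' h2 (by simpa using h1))
  rw [List.append_assoc, List.append_eq_append_iff] at hXY
  rcases hXY with ⟨E, h1, h2⟩ | ⟨E, h1, h2⟩
  · exact hleft E h1 h2
  · cases E with
    | nil => exact hleft [] (by simpa using h1.symm) (by simpa using h2.symm)
    -- The window starts after at least one copy of `c`, and deleting this copy in front of it
    -- leaves it intact.
    | cons e E =>
      left
      rw [List.replicate_succ] at h2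
      simp only [List.cons_append, List.cons.injEq] at h2
      refine ⟨A ++ E, Y, ?_⟩
      conv_rhs => rw [hL, h2.2]
      simp

theorem infix_ins_iff_split {L W : List ℝ} {c : ℝ} (hlen : W.length = L.length) :
    W <:+: ins c L ↔ W = (ins c L).dropLast ∨ W = (ins c L).tail := by
  have hl := length_ins c L
  constructor
  · rintro ⟨X, Y, h⟩
    have h' := congrArg List.length h
    simp only [List.length_append] at h'
    rw [hl, hlen] at h'
    rcases X with _ | ⟨x, X⟩
    · left
      obtain ⟨y, hy⟩ : ∃ y, Y = [y] := List.length_eq_one_iff.1 (by simp at h'; omega)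
      rw [← h, hy]; simp
    · right
      have hX : X = [] := List.length_eq_zero_iff.1 (by simp at h'; omega)
      have hY : Y = [] := List.length_eq_zero_iff.1 (by simp at h'; omega)
      rw [← h, hX, hY]; simp
  · rintro (rfl | rfl)
    · exact (List.dropLast_prefix _).isInfix
    · exact (List.tail_suffix _).isInfix

/-! ### Splitting of B-splines -/

theorem ne_nil_of_first_lt_last {L : List ℝ} (h : firstKnot L < lastKnot L) : L ≠ [] := by
  rintro rfl
  exact lt_irrefl _ h

/-- By sortedness, knots left of the window are at most its first knot and knots right of it at
least its last one, so no copy of an interior value lies outside. -/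
theorem count_eq_of_infix {L W : List ℝ} (h : Srt L) (hW : W <:+: L) {x : ℝ}
    (hx1 : firstKnot W < x) (hx2 : x < lastKnot W) : W.count x = L.count x := by
  obtain ⟨X, Y, rfl⟩ := hW
  have hWne := ne_nil_of_first_lt_last (hx1.trans hx2)
  rw [Srt, List.append_assoc, List.pairwise_append, List.pairwise_append] at h
  have hX : x ∉ X := fun hx => absurd (h.2.2 x hx (firstKnot W)
    (List.mem_append_left _ (firstKnot_mem hWne))) (not_le.2 hx1)
  have hY : x ∉ Y := fun hx => absurd (h.2.1.2.2 _ (lastKnot_mem hWne) x hx) (not_le.2 hx2)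
  simp [List.count_eq_zero_of_not_mem hX, List.count_eq_zero_of_not_mem hY]

theorem count_add_two_le {L : List ℝ} (h : Srt L) {c : ℝ} (h1 : firstKnot L < c)
    (h2 : c < lastKnot L) : L.count c + 2 ≤ L.length := by
  have hne : L ≠ [] := ne_nil_of_first_lt_last (h1.trans h2)
  obtain ⟨A, D, hL, hA, hD⟩ := h.decompose c
  have hmem : ∀ x ∈ L, x ∈ A ∨ x = c ∨ x ∈ D := by
    intro x hx
    rw [hL, List.mem_append, List.mem_append] at hx
    exact hx.imp_right (Or.imp_left List.eq_of_mem_replicate)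
  have hf := hmem _ (firstKnot_mem hne)
  have hl := hmem _ (lastKnot_mem hne)
  have hA' : A ≠ [] := by
    rintro rfl
    rcases hf with hf | hf | hf
    · simp at hf
    · exact h1.ne hf
    · exact lt_asymm h1 (hD _ hf)
  have hD' : D ≠ [] := by
    rintro rfl
    rcases hl with hl | hl | hl
    · exact lt_asymm h2 (hA _ hl)
    · exact h2.ne' hl
    · simp at hl
  have := congrArg List.length hL
  have h3 := List.length_pos_iff.2 hA'
  have h4 := List.length_pos_iff.2 hD'
  simp only [List.length_append, List.length_replicate] at this
  omega

/-- The windows resulting from the insertion of an interior knot. -/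
theorem window_ins_bounds {L W : List ℝ} (h : Srt L) {c : ℝ} (h1 : firstKnot L < c)
    (h2 : c < lastKnot L) (hW : W <:+: ins c L) (hlen : W.length = L.length) :
    firstKnot L ≤ firstKnot W ∧ lastKnot W ≤ lastKnot L ∧ firstKnot W < lastKnot W ∧
      firstKnot W ≤ c ∧ c ≤ lastKnot W := by
  have hne : L ≠ [] := ne_nil_of_first_lt_last (h1.trans h2)
  have hWne : W ≠ [] := by
    rintro rfl
    exact hne (List.length_eq_zero_iff.1 hlen.symm)
  have hsi := h.ins c
  have hsW := hsi.infix hW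
  have hine : ins c L ≠ [] := fun h0 => by
    have := length_ins c L
    rw [h0] at this
    simp at this
  have hmem : ∀ x ∈ ins c L, firstKnot L ≤ x ∧ x ≤ lastKnot L := by
    intro x hx
    rcases mem_ins.1 hx with rfl | hx
    · exact ⟨h1.le, h2.le⟩
    · exact ⟨firstKnot_le h hx, le_lastKnot h hx⟩
  have hfl : firstKnot (ins c L) = firstKnot L :=
    le_antisymm (firstKnot_le hsi (mem_ins.2 (Or.inr (firstKnot_mem hne))))
      (hmem _ (firstKnot_mem hine)).1
  have hll : lastKnot (ins c L) = lastKnot L :=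
    le_antisymm (hmem _ (lastKnot_mem hine)).2
      (le_lastKnot hsi (mem_ins.2 (Or.inr (lastKnot_mem hne))))
  have hcin : c ∈ ins c L := mem_ins.2 (Or.inl rfl)
  have hlin : lastKnot L ∈ ins c L := mem_ins.2 (Or.inr (lastKnot_mem hne))
  have hfin : firstKnot L ∈ ins c L := mem_ins.2 (Or.inr (firstKnot_mem hne))
  refine ⟨(hmem _ (hW.subset (firstKnot_mem hWne))).1,
    (hmem _ (hW.subset (lastKnot_mem hWne))).2, ?_⟩
  rcases (infix_ins_iff_split hlen).1 hW with rfl | rfl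
  · have hdec := List.dropLast_append_getLast hine
    have hlast : (ins c L).getLast hine = lastKnot L := by
      rw [← hll]
      conv_rhs => rw [← hdec]
      rw [lastKnot_append_singleton]
    rw [hlast] at hdec
    have hm : ∀ x ∈ ins c L, x ≠ lastKnot L → x ∈ (ins c L).dropLast := by
      intro x hx hxl
      rw [← hdec] at hx
      simpa [hxl] using hx
    have hc := hm c hcin h2.ne
    have hf := hm _ hfin (h1.trans h2).ne
    have a1 := firstKnot_le hsW hf
    have a2 := le_lastKnot hsW hc
    exact ⟨by linarith, by linarith, a2⟩
  · obtain ⟨y, Z, hyZ⟩ := List.exists_cons_of_ne_nil hine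
    rw [hyZ, firstKnot_cons] at hfl
    subst hfl
    have hm : ∀ x ∈ ins c L, x ≠ firstKnot L → x ∈ (ins c L).tail := by
      intro x hx hxl
      rw [hyZ] at hx ⊢
      simpa [hxl] using hx
    have hc := hm c hcin h1.ne'
    have hf := hm _ hlin (h1.trans h2).ne'
    have a1 := firstKnot_le hsW hc
    have a2 := le_lastKnot hsW hf
    exact ⟨by linarith, a1, by linarith⟩

/-- Well-formed local knot vectors of bidegree `p` in the rectangle with corners `lo`, `hi`. -/
structure Reg (p : Fin 2 → ℕ) (lo hi : Fin 2 → ℝ) (B : LocalKnots) : Prop where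
  srt : ∀ k, Srt (B k)
  len : ∀ k, (B k).length = p k + 2
  lt : ∀ k, firstKnot (B k) < lastKnot (B k)
  lo_le : ∀ k, lo k ≤ firstKnot (B k)
  le_hi : ∀ k, lastKnot (B k) ≤ hi k

theorem Reg.update {p lo hi B} (h : Reg p lo hi B) {k : Fin 2} {W : List ℝ} (hs : Srt W)
    (hl : W.length = (B k).length) (hlt : firstKnot W < lastKnot W)
    (h1 : firstKnot (B k) ≤ firstKnot W) (h2 : lastKnot W ≤ lastKnot (B k)) :
    Reg p lo hi (Function.update B k W) := by
  constructor <;> intro k' <;> by_cases hk : k' = k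
  all_goals first
    | (subst hk; simp only [Function.update_self])
    | simp only [Function.update_of_ne hk]
  · exact hs
  · exact h.srt k'
  · rw [hl, h.len]
  · exact h.len k'
  · exact hlt
  · exact h.lt k'
  · exact (h.lo_le k').trans h1
  · exact h.lo_le k'
  · exact h2.trans (h.le_hi k')
  · exact h.le_hi k'

theorem Reg.update_ins {p lo hi B} (h : Reg p lo hi B) {k : Fin 2} {c : ℝ} {W : List ℝ}
    (h1 : firstKnot (B k) < c) (h2 : c < lastKnot (B k)) (hW : W <:+: ins c (B k))
    (hl : W.length = (B k).length) : Reg p lo hi (Function.update B k W) := by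
  obtain ⟨a1, a2, a3, -⟩ := window_ins_bounds (h.srt k) h1 h2 hW hl
  exact h.update (((h.srt k).ins c).infix hW) hl a3 a1 a2

theorem Traverses.of_le {M M' : Mesh} {B B' : LocalKnots} {k : Fin 2} {c : ℝ}
    (h : Traverses M B k c) (h1 : firstKnot (B' k) < c) (h2 : c < lastKnot (B' k))
    (hc : (B' k).count c ≤ (B k).count c) (hs : B'.supp (1 - k) ⊆ B.supp (1 - k))
    (hM : ∀ k c t, M.mult k c t ≤ M'.mult k c t) : Traverses M' B' k c :=
  ⟨h1, h2, fun t ht => hc.trans_lt ((h.2.2 t (hs ht)).trans_le (hM _ _ _))⟩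

/-- The two halves are the only windows of the old length in the extended knot vector. This
symmetric form allows arguments about windows instead of cases. -/
theorem splitsTo_iff {M : Mesh} {B B' : LocalKnots} :
    SplitsTo M B B' ↔ ∃ k c W, Traverses M B k c ∧ W <:+: ins c (B k) ∧
      W.length = (B k).length ∧ B' = Function.update B k W := by
  constructor
  · rintro ⟨k, c, h, h' | h'⟩
    · refine ⟨k, c, _, h, (List.dropLast_prefix _).isInfix, ?_, h'⟩
      rw [List.length_dropLast, length_ins]; rfl
    · refine ⟨k, c, _, h, (List.tail_suffix _).isInfix, ?_, h'⟩
      rw [List.length_tail, length_ins]; rfl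
  · rintro ⟨k, c, W, h, hW, hl, rfl⟩
    refine ⟨k, c, h, ?_⟩
    rcases (infix_ins_iff_split hl).1 hW with h' | h'
    · left; rw [← h']
    · right; rw [← h']

/-- `B'` is obtained from `B` by successive knot insertions along `M`. -/
abbrev Reach (M : Mesh) : LocalKnots → LocalKnots → Prop := Relation.ReflTransGen (SplitsTo M)

theorem SplitsTo.reg {p lo hi M B B'} (hB : Reg p lo hi B) (h : SplitsTo M B B') :
    Reg p lo hi B' := by
  obtain ⟨k, c, W, ht, hW, hl, rfl⟩ := splitsTo_iff.1 h
  exact hB.update_ins ht.1 ht.2.1 hW hl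

theorem Reach.reg {p lo hi M B B'} (hB : Reg p lo hi B) (h : Reach M B B') :
    Reg p lo hi B' := by
  induction h with
  | refl => exact hB
  | tail _ h ih => exact SplitsTo.reg ih h

theorem SplitsTo.mono {M M' : Mesh} (hM : ∀ k c t, M.mult k c t ≤ M'.mult k c t) {B B'}
    (h : SplitsTo M B B') : SplitsTo M' B B' := by
  obtain ⟨k, c, W, ht, h⟩ := splitsTo_iff.1 h
  exact splitsTo_iff.2 ⟨k, c, W, ht.of_le ht.1 ht.2.1 le_rfl subset_rfl hM, h⟩

theorem Reach.mono {M M' : Mesh} (hM : ∀ k c t, M.mult k c t ≤ M'.mult k c t) {B B'}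
    (h : Reach M B B') : Reach M' B B' :=
  Relation.ReflTransGen.mono (fun _ _ => SplitsTo.mono hM) _ _ h

theorem supp_update_of_ne {B : LocalKnots} {k k' : Fin 2} (h : k' ≠ k) (W : List ℝ) :
    LocalKnots.supp (Function.update B k W) k' = B.supp k' := by
  simp [LocalKnots.supp, Function.update_of_ne h]

theorem supp_update_subset {B : LocalKnots} {k : Fin 2} {W : List ℝ}
    (h1 : firstKnot (B k) ≤ firstKnot W) (h2 : lastKnot W ≤ lastKnot (B k)) (k' : Fin 2) :
    LocalKnots.supp (Function.update B k W) k' ⊆ B.supp k' := by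
  by_cases h : k' = k
  · subst h
    simp only [LocalKnots.supp, Function.update_self]
    exact Set.Icc_subset_Icc h1 h2
  · rw [supp_update_of_ne h]

theorem one_sub_ne (k : Fin 2) : 1 - k ≠ k := by
  fin_cases k <;> decide

theorem eq_one_sub {k k' : Fin 2} (h : k' ≠ k) : k' = 1 - k := by
  fin_cases k <;> fin_cases k' <;> simp_all

/-- If `B` is traversed at `c`, then every B-spline with minimal support reachable from `B` is
reachable from one of the B-splines resulting from the insertion of `c`. -/
theorem exists_window_reach {p lo hi} {M : Mesh} {B B' : LocalKnots} (hB : Reg p lo hi B)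
    (h : Reach M B B') (hmin : MinimalSupport M B') :
    ∀ k c, Traverses M B k c → ∃ W, W <:+: ins c (B k) ∧ W.length = (B k).length ∧
      Reach M (Function.update B k W) B' := by
  induction h using Relation.ReflTransGen.head_induction_on with
  | refl => exact fun k c h => absurd h (hmin k c)
  | @head B B1 hstep hreach ih =>
    intro k c ht
    have ih := ih (hstep.reg hB)
    obtain ⟨k', c', W1, ht', hW1, hl1, rfl⟩ := splitsTo_iff.1 hstep
    obtain ⟨b1, b2, b3, b4, b5⟩ := window_ins_bounds (hB.srt k') ht'.1 ht'.2.1 hW1 hl1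
    by_cases hk : k' = k
    · subst hk
      rcases eq_or_ne c c' with rfl | hc
      · exact ⟨W1, hW1, hl1, hreach⟩
      have hW1ne : W1 ≠ [] := ne_nil_of_first_lt_last b3
      -- Insertions in the same direction: after swapping the order of `c` and `c'`, the window `W2`
      -- either appears once `c` alone is inserted, or comes from a window `V` of that list by the
      -- later insertion of `c'`.
      have hfin : ∀ W2, W2 <:+: ins c (ins c' (B k')) → W2.length = (B k').length →
          Reach M (Function.update B k' W2) B' → ∃ W, W <:+: ins c (B k') ∧
          W.length = (B k').length ∧ Reach M (Function.update B k' W) B' := by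
        intro W2 hW2 hl2 hr
        rw [ins_comm (hB.srt k')] at hW2
        have hne := ne_nil_of_first_lt_last (hB.lt k')
        rcases window_of_ins ((hB.srt k').ins c) ⟨_, mem_ins.2 (Or.inr (firstKnot_mem hne)), ht'.1⟩
          ⟨_, mem_ins.2 (Or.inr (lastKnot_mem hne)), ht'.2.1⟩
          (by
            rw [count_ins_of_ne hc.symm, hl2]
            have := count_add_two_le (hB.srt k') ht'.1 ht'.2.1
            omega) hW2 (by rw [hl2, length_ins]; omega) with h | ⟨V, hV, hVl, hV1, hV2, hW2V⟩
        · exact ⟨W2, h, hl2, hr⟩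
        · refine ⟨V, hV, hVl.trans hl2, Relation.ReflTransGen.head (splitsTo_iff.2
            ⟨k', c', W2, ?_, ?_, ?_, ?_⟩) hr⟩
          · refine ht'.of_le (by simpa using hV1) (by simpa using hV2) ?_ ?_ (fun _ _ _ => le_rfl)
            · rw [Function.update_self, ← count_ins_of_ne hc.symm (B k')]
              exact hV.sublist.count_le _
            · rw [supp_update_of_ne (one_sub_ne k')]
          · simpa using hW2V
          · simpa using hVl.symm
          · simp
      -- If `c` is not interior to `W1`, inserting it does not affect this half; if it is, `W1` is
      -- still traversed at `c` and the induction hypothesis applies.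
      by_cases h1 : c ≤ firstKnot W1
      · exact hfin W1 (infix_ins_of_le_first ((hB.srt k').ins c') hW1 hW1ne h1) hl1 hreach
      by_cases h2 : lastKnot W1 ≤ c
      · exact hfin W1 (infix_ins_of_last_le ((hB.srt k').ins c') hW1 hW1ne h2) hl1 hreach
      push Not at h1 h2
      obtain ⟨W2, hW2, hl2, hr⟩ := ih k' c (by
        refine ht.of_le (by simpa using h1) (by simpa using h2) ?_ ?_ (fun _ _ _ => le_rfl)
        · rw [Function.update_self, ← count_ins_of_ne hc (B k')]
          exact hW1.sublist.count_le _
        · rw [supp_update_of_ne (one_sub_ne k')])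
      simp only [Function.update_self, Function.update_idem] at hW2 hl2 hr
      refine hfin W2 (hW2.trans ?_) (hl2.trans hl1) hr
      exact ins_infix_ins ((hB.srt k').ins c') hW1 hW1ne h1.le h2.le
    -- Insertions in different directions commute: each only shrinks the support along which the
    -- other line has to be present.
    · have hk' := eq_one_sub hk
      obtain ⟨W, hW, hl, hr⟩ := ih k c (by
        refine ht.of_le ?_ ?_ ?_ ?_ (fun _ _ _ => le_rfl)
        · rw [Function.update_of_ne (Ne.symm hk)]; exact ht.1
        · rw [Function.update_of_ne (Ne.symm hk)]; exact ht.2.1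
        · rw [Function.update_of_ne (Ne.symm hk)]
        · exact supp_update_subset b1 b2 _)
      rw [Function.update_of_ne (Ne.symm hk)] at hW hl
      refine ⟨W, hW, hl, Relation.ReflTransGen.head (splitsTo_iff.2 ⟨k', c', W1, ?_, ?_, ?_, ?_⟩) hr⟩
      · obtain ⟨a1, a2, -⟩ := window_ins_bounds (hB.srt k) ht.1 ht.2.1 hW hl
        refine ht'.of_le ?_ ?_ ?_ ?_ (fun _ _ _ => le_rfl)
        · rw [Function.update_of_ne hk]; exact ht'.1
        · rw [Function.update_of_ne hk]; exact ht'.2.1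
        · rw [Function.update_of_ne hk]
        · exact supp_update_subset a1 a2 _
      · rwa [Function.update_of_ne hk]
      · rwa [Function.update_of_ne hk]
      · exact Function.update_comm (Ne.symm hk) _ _ _ |>.symm

/-! ### Termination and independence of the order of the insertions -/

/-- All meshlines lie on finitely many lines, with bounded multiplicities. -/
def Mesh.FinLines (M : Mesh) (G : Finset ℝ) (n : ℕ) : Prop :=
  ∀ k c t, M.mult k c t ≤ n ∧ (M.mult k c t ≠ 0 → c ∈ G)

/-- The number of knots that can be inserted in `L`. -/
def room (G : Finset ℝ) (n : ℕ) (L : List ℝ) : ℕ :=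
  ∑ c ∈ G with firstKnot L < c ∧ c < lastKnot L, (n - L.count c)

/-- The support shrinks and no interior count decreases, so no summand grows. For the inserted knot,
either its count goes up or it leaves the interior and its positive summand disappears. -/
theorem room_lt {G : Finset ℝ} {n : ℕ} {L W : List ℝ} {c : ℝ} (hs : Srt L) (h1 : firstKnot L < c)
    (h2 : c < lastKnot L) (hc : L.count c < n) (hG : c ∈ G) (hW : W <:+: ins c L)
    (hl : W.length = L.length) : room G n W < room G n L := by
  obtain ⟨a1, a2, a3, a4, a5⟩ := window_ins_bounds hs h1 h2 hW hl
  unfold room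
  have hcount : ∀ x, firstKnot W < x → x < lastKnot W → W.count x = (ins c L).count x :=
    fun x hx1 hx2 => count_eq_of_infix (hs.ins c) hW hx1 hx2
  have hsub : G.filter (fun c => firstKnot W < c ∧ c < lastKnot W) ⊆
      G.filter (fun c => firstKnot L < c ∧ c < lastKnot L) := by
    intro x hx
    simp only [Finset.mem_filter] at hx ⊢
    exact ⟨hx.1, a1.trans_lt hx.2.1, hx.2.2.trans_le a2⟩
  have hcL : c ∈ G.filter (fun c => firstKnot L < c ∧ c < lastKnot L) := by
    simp [hG, h1, h2]
  have hterm : ∀ x ∈ G.filter (fun c => firstKnot W < c ∧ c < lastKnot W),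
      n - W.count x ≤ n - L.count x := by
    intro x hx
    simp only [Finset.mem_filter] at hx
    rw [hcount x hx.2.1 hx.2.2, count_ins]
    omega
  by_cases hcW : firstKnot W < c ∧ c < lastKnot W
  · refine lt_of_lt_of_le (Finset.sum_lt_sum hterm ⟨c, by simp [hG, hcW], ?_⟩)
      (Finset.sum_le_sum_of_subset hsub)
    rw [hcount c hcW.1 hcW.2, count_ins, if_pos rfl]
    omega
  · refine lt_of_le_of_lt (Finset.sum_le_sum hterm)
      (Finset.sum_lt_sum_of_subset hsub hcL (by simp [hcW]) (by omega) (by simp))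

/-- The total number of knots that can be inserted in `B`. -/
def LocalKnots.room (G : Finset ℝ) (n : ℕ) (B : LocalKnots) : ℕ :=
  ∑ k, LRSpline.room G n (B k)

theorem room_update_lt {p lo hi} {M : Mesh} {G : Finset ℝ} {n : ℕ} (hM : M.FinLines G n)
    {B : LocalKnots} (hB : Reg p lo hi B) {k : Fin 2} {c : ℝ} (h : Traverses M B k c)
    {W : List ℝ} (hW : W <:+: ins c (B k)) (hl : W.length = (B k).length) :
    LocalKnots.room G n (Function.update B k W) < LocalKnots.room G n B := by
  obtain ⟨h1, h2, h3⟩ := h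
  have h3 := h3 (firstKnot (B (1 - k))) ⟨le_rfl, (hB.lt _).le⟩
  have h4 := hM k c (firstKnot (B (1 - k)))
  refine Finset.sum_lt_sum (fun k' _ => ?_) ⟨k, Finset.mem_univ _, ?_⟩
  · by_cases hk : k' = k
    · subst hk
      rw [Function.update_self]
      exact (room_lt (hB.srt k') h1 h2 (by omega) (h4.2 (by omega)) hW hl).le
    · rw [Function.update_of_ne hk]
  · rw [Function.update_self]
    exact room_lt (hB.srt k) h1 h2 (by omega) (h4.2 (by omega)) hW hl

/-- Refinement along a finer mesh can start with the refinement along a coarser mesh. -/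
theorem exists_reach_between {p lo hi} {M M' : Mesh} {G : Finset ℝ} {n : ℕ} (hM : M.FinLines G n)
    (hle : ∀ k c t, M.mult k c t ≤ M'.mult k c t) {B B' : LocalKnots} (hB : Reg p lo hi B)
    (h : Reach M' B B') (hmin : MinimalSupport M' B') :
    ∃ B1, Reach M B B1 ∧ MinimalSupport M B1 ∧ Reach M' B1 B' := by
  induction hr : LocalKnots.room G n B using Nat.strong_induction_on generalizing B with
  | _ r ih =>
    by_cases hB' : MinimalSupport M B
    · exact ⟨B, .refl, hB', h⟩
    · simp only [MinimalSupport, not_forall, not_not] at hB'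
      obtain ⟨k, c, ht⟩ := hB'
      obtain ⟨W, hW, hl, hW'⟩ := exists_window_reach hB h hmin k c
        (ht.of_le ht.1 ht.2.1 le_rfl subset_rfl hle)
      obtain ⟨B1, h1, h2, h3⟩ := ih _ (hr ▸ room_update_lt hM hB ht hW hl)
        (hB.update_ins ht.1 ht.2.1 hW hl) hW' rfl
      exact ⟨B1, .head (splitsTo_iff.2 ⟨k, c, W, ht, hW, hl, rfl⟩) h1, h2, h3⟩

/-- Allows a chain of refinements along growing meshes to be replaced by one refinement along the
last mesh. -/
theorem refine_refine {p lo hi} {M M' : Mesh} {G : Finset ℝ} {n : ℕ} (hM : M.FinLines G n)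
    (hle : ∀ k c t, M.mult k c t ≤ M'.mult k c t) {S : Set LocalKnots}
    (hS : ∀ B ∈ S, Reg p lo hi B) : refine M' (refine M S) = refine M' S := by
  ext B'
  constructor
  · rintro ⟨hmin, B1, ⟨-, B, hBS, h⟩, h'⟩
    exact ⟨hmin, B, hBS, (Reach.mono hle h).trans h'⟩
  · rintro ⟨hmin, B, hBS, h⟩
    obtain ⟨B1, h1, h2, h3⟩ := exists_reach_between hM hle (hS B hBS) h hmin
    exact ⟨hmin, B1, ⟨h2, B, hBS, h1⟩, h3⟩

/-! ### Insertion of several knots -/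

/-- Insertion of the knots `D` in the knot vector `Ξ`. -/
def insAll (D Ξ : List ℝ) : List ℝ := D.foldr ins Ξ

theorem insAll_cons (c : ℝ) (D Ξ : List ℝ) : insAll (c :: D) Ξ = ins c (insAll D Ξ) := rfl

theorem Srt.insAll {Ξ : List ℝ} (h : Srt Ξ) (D : List ℝ) : Srt (insAll D Ξ) := by
  induction D with
  | nil => exact h
  | cons c D ih => exact Srt.ins ih c

theorem perm_insAll (D Ξ : List ℝ) : (insAll D Ξ).Perm (D ++ Ξ) := by
  induction D with
  | nil => rfl
  | cons c D ih => exact (perm_ins _ _).trans (ih.cons c)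

theorem count_insAll (D Ξ : List ℝ) (c : ℝ) : (insAll D Ξ).count c = D.count c + Ξ.count c := by
  rw [(perm_insAll D Ξ).count_eq, List.count_append]

theorem length_insAll (D Ξ : List ℝ) : (insAll D Ξ).length = D.length + Ξ.length := by
  rw [(perm_insAll D Ξ).length_eq, List.length_append]

/-- Each knot of `D` interior to the current window is a traversing one, as the mesh carries its
final multiplicity, and `exists_window_reach` inserts it first; the other knots leave the window as
it is. -/
theorem exists_window_insAll_reach {p lo hi} {M : Mesh} {B B' : LocalKnots} {k : Fin 2}
    {Ξ D : List ℝ} (hΞ : Srt Ξ) (hB : Reg p lo hi B) (hBk : B k <:+: Ξ)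
    (hmult : ∀ c ∈ D, ∀ t ∈ B.supp (1 - k), (insAll D Ξ).count c ≤ M.mult k c t)
    (h : Reach M B B') (hmin : MinimalSupport M B') :
    ∃ W, W <:+: insAll D Ξ ∧ W.length = (B k).length ∧
      Reg p lo hi (Function.update B k W) ∧ Reach M (Function.update B k W) B' := by
  induction D with
  | nil => exact ⟨B k, hBk, rfl, by simpa using hB, by simpa using h⟩
  | cons c D ih =>
    obtain ⟨W, hW, hl, hreg, hr⟩ := ih (fun c' hc' t ht => by
      refine le_trans ?_ (hmult c' (List.mem_cons_of_mem _ hc') t ht)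
      rw [insAll_cons, count_ins]; omega)
    have hWlt : firstKnot W < lastKnot W := by simpa using hreg.lt k
    have hWne := ne_nil_of_first_lt_last hWlt
    by_cases h1 : c ≤ firstKnot W
    · exact ⟨W, infix_ins_of_le_first (hΞ.insAll D) hW hWne h1, hl, hreg, hr⟩
    by_cases h2 : lastKnot W ≤ c
    · exact ⟨W, infix_ins_of_last_le (hΞ.insAll D) hW hWne h2, hl, hreg, hr⟩
    push Not at h1 h2
    obtain ⟨W', hW', hl', hr'⟩ := exists_window_reach hreg hr hmin k c (by
      refine ⟨by simpa using h1, by simpa using h2, fun t ht => ?_⟩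
      rw [supp_update_of_ne (one_sub_ne k)] at ht
      refine lt_of_lt_of_le ?_ (hmult c (by simp) t ht)
      rw [insAll_cons, count_ins, if_pos rfl, Function.update_self]
      exact Nat.lt_succ_of_le (hW.sublist.count_le c))
    have hreg' := hreg.update_ins (k := k) (c := c) (W := W') (by simpa using h1)
      (by simpa using h2) hW' hl'
    simp only [Function.update_self, Function.update_idem] at hW' hl' hr' hreg'
    exact ⟨W', hW'.trans (ins_infix_ins (hΞ.insAll D) hW hWne h1.le h2.le), hl'.trans hl,
      hreg', hr'⟩

/-- The converse direction: `window_of_ins` removes the inserted knots one at a time, and each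
removal that changes the window is a split read backwards. -/
theorem exists_window_reach_of_insAll {M : Mesh} {B : LocalKnots} {k : Fin 2}
    {Ξ D : List ℝ} (hΞ : Srt Ξ) (hBk : B k <:+: insAll D Ξ) (hlen : (B k).length ≤ Ξ.length)
    (hlt : ∀ c ∈ D, ∃ x ∈ Ξ, x < c) (hgt : ∀ c ∈ D, ∃ x ∈ Ξ, c < x)
    (hcount : ∀ c ∈ D, (insAll D Ξ).count c < (B k).length)
    (hmult : ∀ c ∈ D, ∀ t ∈ B.supp (1 - k), (insAll D Ξ).count c ≤ M.mult k c t) :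
    ∃ V, V <:+: Ξ ∧ V.length = (B k).length ∧ Reach M (Function.update B k V) B := by
  induction D generalizing B with
  | nil => exact ⟨B k, hBk, rfl, by rw [Function.update_eq_self]⟩
  | cons c D ih =>
    have hc : ∀ c' ∈ D, (insAll D Ξ).count c' ≤ (insAll (c :: D) Ξ).count c' := fun c' _ => by
      rw [insAll_cons, count_ins]; omega
    have hmem : ∀ x ∈ Ξ, x ∈ insAll D Ξ := fun x hx =>
      (perm_insAll D Ξ).mem_iff.2 (List.mem_append_right _ hx)
    have ih := fun (B : LocalKnots) hBk hlen hcount hmult => @ih B hBk hlen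
      (fun c' h => hlt c' (List.mem_cons_of_mem _ h))
      (fun c' h => hgt c' (List.mem_cons_of_mem _ h)) hcount hmult
    rcases window_of_ins (hΞ.insAll D)
      (let ⟨x, hx, h⟩ := hlt c (by simp); ⟨x, hmem x hx, h⟩)
      (let ⟨x, hx, h⟩ := hgt c (by simp); ⟨x, hmem x hx, h⟩)
      (by simpa [insAll_cons, count_ins] using hcount c (by simp)) hBk
      (by rw [length_insAll]; omega) with h | ⟨V, hV, hVl, hV1, hV2, hVB⟩
    · exact ih B h hlen
        (fun c' h => (hc c' h).trans_lt (hcount c' (List.mem_cons_of_mem _ h)))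
        (fun c' h t ht => (hc c' h).trans (hmult c' (List.mem_cons_of_mem _ h) t ht))
    · obtain ⟨V', hV', hl', hr'⟩ := ih (Function.update B k V) (by simpa using hV)
        (by simpa [hVl] using hlen)
        (fun c' h => by
          simpa [hVl] using (hc c' h).trans_lt (hcount c' (List.mem_cons_of_mem _ h)))
        (fun c' h t ht => by
          rw [supp_update_of_ne (one_sub_ne k)] at ht
          exact (hc c' h).trans (hmult c' (List.mem_cons_of_mem _ h) t ht))
      simp only [Function.update_self, Function.update_idem] at hl' hr'
      refine ⟨V', hV', hl'.trans hVl, hr'.tail (splitsTo_iff.2 ⟨k, c, B k, ?_, ?_, ?_, ?_⟩)⟩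
      · refine ⟨by simpa using hV1, by simpa using hV2, fun t ht => ?_⟩
        rw [supp_update_of_ne (one_sub_ne k)] at ht
        refine lt_of_lt_of_le ?_ (hmult c (by simp) t ht)
        rw [insAll_cons, count_ins, if_pos rfl, Function.update_self]
        exact Nat.lt_succ_of_le (hV.sublist.count_le c)
      · simpa using hVB
      · simpa using hVl.symm
      · simp

/-! ### The LR B-splines are determined by the mesh -/

/-- The open knot vectors without internal knots. -/
def bernKnots (p : Fin 2 → ℕ) (lo hi : Fin 2 → ℝ) (k : Fin 2) : List ℝ :=
  List.replicate (p k + 1) (lo k) ++ List.replicate (p k + 1) (hi k)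

/-- The Bernstein polynomials of bidegree `p`, as B-splines. -/
def bern (p : Fin 2 → ℕ) (lo hi : Fin 2 → ℝ) : Set LocalKnots :=
  tensorBSplines p (bernKnots p lo hi)

theorem isOpenKnotVector_bernKnots (p : Fin 2 → ℕ) {lo hi : Fin 2 → ℝ} (h : ∀ k, lo k < hi k)
    (k : Fin 2) : IsOpenKnotVector (p k) (lo k) (hi k) (bernKnots p lo hi k) := by
  have hk := h k
  unfold bernKnots
  refine ⟨?_, ?_, ?_, ?_, ?_⟩
  · rw [List.pairwise_append]
    refine ⟨by simp [List.pairwise_replicate], by simp [List.pairwise_replicate], ?_⟩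
    intro a ha b hb
    rw [List.eq_of_mem_replicate ha, List.eq_of_mem_replicate hb]
    exact hk.le
  · intro c hc
    rcases List.mem_append.1 hc with hc | hc <;> rw [List.eq_of_mem_replicate hc]
    · exact ⟨le_rfl, hk.le⟩
    · exact ⟨hk.le, le_rfl⟩
  · simp [List.count_replicate, hk.ne']
  · simp [List.count_replicate, hk.ne]
  · intro c
    rw [List.count_append, List.count_replicate, List.count_replicate]
    by_cases h1 : lo k = c
    · subst h1; simp [hk.ne']
    · simp [h1]; split_ifs <;> omega

theorem first_lt_last_of_count {L : List ℝ} (h : Srt L) (hne : L ≠ [])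
    (hc : ∀ c, L.count c < L.length) : firstKnot L < lastKnot L := by
  rcases lt_or_eq_of_le (firstKnot_le h (lastKnot_mem hne)) with h1 | h1
  · exact h1
  · exfalso
    have : L.count (firstKnot L) = L.length := by
      rw [List.count_eq_length]
      intro b hb
      exact le_antisymm (firstKnot_le h hb) (h1 ▸ le_lastKnot h hb)
    exact (hc _).ne this

/-- No value occurs more than `p k + 1` times, so `p k + 2` consecutive knots cannot all coincide.
-/
theorem reg_of_mem_tensorBSplines {p : Fin 2 → ℕ} {lo hi : Fin 2 → ℝ} {Ξ : Fin 2 → List ℝ}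
    (hΞ : ∀ k, IsOpenKnotVector (p k) (lo k) (hi k) (Ξ k)) {B : LocalKnots}
    (hB : B ∈ tensorBSplines p Ξ) : Reg p lo hi B := by
  have hs : ∀ k, Srt (B k) := fun k => Srt.infix (hΞ k).1 (hB k).1
  have hne : ∀ k, B k ≠ [] := fun k h => by
    have := (hB k).2
    rw [h] at this
    simp at this
  refine ⟨hs, fun k => (hB k).2, fun k => first_lt_last_of_count (hs k) (hne k) fun c => ?_,
    fun k => ?_, fun k => ?_⟩
  · have h1 := (hB k).1.sublist.count_le c
    have h2 := (hΞ k).2.2.2.2 c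
    rw [(hB k).2]
    omega
  · exact ((hΞ k).2.1 _ ((hB k).1.subset (firstKnot_mem (hne k)))).1
  · exact ((hΞ k).2.1 _ ((hB k).1.subset (lastKnot_mem (hne k)))).2

theorem reg_of_mem_bern {p : Fin 2 → ℕ} {lo hi : Fin 2 → ℝ} (h : ∀ k, lo k < hi k)
    {B : LocalKnots} (hB : B ∈ bern p lo hi) : Reg p lo hi B :=
  reg_of_mem_tensorBSplines (isOpenKnotVector_bernKnots p h) hB

theorem Reg.supp_subset {p lo hi B} (h : Reg p lo hi B) (k : Fin 2) :
    B.supp k ⊆ Set.Icc (lo k) (hi k) :=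
  Set.Icc_subset_Icc (h.lo_le k) (h.le_hi k)

theorem Reg.firstKnot_mem_supp {p lo hi B} (h : Reg p lo hi B) (k : Fin 2) :
    firstKnot (B k) ∈ B.supp k :=
  ⟨le_rfl, (h.lt k).le⟩

theorem IsOpenKnotVector.eq_insAll {p : Fin 2 → ℕ} {lo hi : Fin 2 → ℝ} (h : ∀ k, lo k < hi k)
    {k : Fin 2} {L : List ℝ} (hL : IsOpenKnotVector (p k) (lo k) (hi k) L) :
    L = insAll (L.filter fun c => lo k < c ∧ c < hi k) (bernKnots p lo hi k) := by
  obtain ⟨h1, h2, h3, h4, h5⟩ := hL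
  obtain ⟨b1, b2, b3, b4, b5⟩ := isOpenKnotVector_bernKnots p h k
  refine Srt.eq_of_perm h1 (Srt.insAll b1 _) (List.perm_iff_count.2 fun c => ?_)
  rw [count_insAll]
  by_cases hc : lo k < c ∧ c < hi k
  · rw [List.count_filter (by simpa using hc),
      List.count_eq_zero_of_not_mem (l := bernKnots p lo hi k), add_zero]
    simp only [bernKnots, List.mem_append, List.mem_replicate, not_or, not_and]
    exact ⟨fun _ => hc.1.ne', fun _ => hc.2.ne⟩
  · have hcf : c ∉ L.filter fun c => lo k < c ∧ c < hi k := fun h' => hc (by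
      simpa using (List.mem_filter.1 h').2)
    rw [List.count_eq_zero_of_not_mem hcf, zero_add]
    by_cases e1 : c = lo k
    · rw [e1, h3, b3]
    by_cases e2 : c = hi k
    · rw [e2, h4, b4]
    have key : c ∉ Set.Icc (lo k) (hi k) := fun h' =>
      hc ⟨lt_of_le_of_ne h'.1 (Ne.symm e1), lt_of_le_of_ne h'.2 e2⟩
    rw [List.count_eq_zero_of_not_mem fun h' => key (h2 c h'),
      List.count_eq_zero_of_not_mem fun h' => key (b2 c h')]

theorem minimalSupport_tensor {p : Fin 2 → ℕ} {lo hi : Fin 2 → ℝ} (h : ∀ k, lo k < hi k)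
    {Ξ : Fin 2 → List ℝ} (hΞ : ∀ k, IsOpenKnotVector (p k) (lo k) (hi k) (Ξ k)) {B : LocalKnots}
    (hB : B ∈ tensorBSplines p Ξ) : MinimalSupport (tensorMesh lo hi h Ξ) B := by
  have hreg := reg_of_mem_tensorBSplines hΞ hB
  rintro k c ⟨h1, h2, h3⟩
  have ht := hreg.firstKnot_mem_supp (1 - k)
  have h3 := h3 _ ht
  simp only [tensorMesh, if_pos (hreg.supp_subset _ ht)] at h3
  exact h3.ne (count_eq_of_infix (hΞ k).1 (hB k).1 h1 h2)

theorem Reach.eq_of_minimalSupport {M : Mesh} {B B' : LocalKnots} (h : Reach M B B')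
    (hmin : MinimalSupport M B) : B' = B := by
  rcases Relation.ReflTransGen.cases_head h with h | ⟨C, ⟨k, c, ht, -⟩, -⟩
  · exact h.symm
  · exact absurd ht (hmin k c)

/-- In a tensor mesh every line runs across the whole domain, so all internal knots can be inserted
in the Bernstein knot vectors, one direction after the other. This is the base case of
`IsLR.eq_refine`. -/
theorem refine_tensor {p : Fin 2 → ℕ} {lo hi : Fin 2 → ℝ} (h : ∀ k, lo k < hi k)
    {Ξ : Fin 2 → List ℝ} (hΞ : ∀ k, IsOpenKnotVector (p k) (lo k) (hi k) (Ξ k)) :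
    tensorBSplines p Ξ = refine (tensorMesh lo hi h Ξ) (bern p lo hi) := by
  set D : Fin 2 → List ℝ := fun k => (Ξ k).filter fun c => lo k < c ∧ c < hi k with hD
  have hΞD : ∀ k, Ξ k = insAll (D k) (bernKnots p lo hi k) := fun k =>
    IsOpenKnotVector.eq_insAll h (hΞ k)
  have hb := isOpenKnotVector_bernKnots p h
  have hmult : ∀ B : LocalKnots, Reg p lo hi B → ∀ k, ∀ c ∈ D k, ∀ t ∈ B.supp (1 - k),
      (insAll (D k) (bernKnots p lo hi k)).count c ≤ (tensorMesh lo hi h Ξ).mult k c t := by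
    intro B hB k c hc t ht
    simp only [tensorMesh, if_pos (hB.supp_subset _ ht), ← hΞD]
    exact le_rfl
  have hDlt : ∀ k, ∀ c ∈ D k, ∃ x ∈ bernKnots p lo hi k, x < c := fun k c hc => by
    simp [D] at hc
    exact ⟨lo k, by simp [bernKnots], hc.2.1⟩
  have hDgt : ∀ k, ∀ c ∈ D k, ∃ x ∈ bernKnots p lo hi k, c < x := fun k c hc => by
    simp [D] at hc
    exact ⟨hi k, by simp [bernKnots], hc.2.2⟩
  have hlen : ∀ k, p k + 2 ≤ (bernKnots p lo hi k).length := fun k => by simp [bernKnots]; omega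
  have hcount : ∀ k, ∀ c ∈ D k, (insAll (D k) (bernKnots p lo hi k)).count c < p k + 2 :=
    fun k c _ => by
      rw [← hΞD]
      exact Nat.lt_succ_of_le ((hΞ k).2.2.2.2 c)
  ext B
  constructor
  · intro hB
    have hreg := reg_of_mem_tensorBSplines hΞ hB
    refine ⟨minimalSupport_tensor h hΞ hB, ?_⟩
    obtain ⟨V0, hV0, hl0, hr0⟩ := exists_window_reach_of_insAll (M := tensorMesh lo hi h Ξ)
      (k := 0) (B := B) (hb 0).1 (hΞD 0 ▸ (hB 0).1)
      (by rw [(hB 0).2]; exact hlen 0) (hDlt 0) (hDgt 0) (by rw [(hB 0).2]; exact hcount 0)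
      (hmult B hreg 0)
    have e1 : Function.update B 0 V0 1 = B 1 := rfl
    have hr00 : LocalKnots.supp (Function.update B 0 V0) (1 - 1) ⊆ Set.Icc (lo 0) (hi 0) := by
      have hs : Srt V0 := Srt.infix (hb 0).1 hV0
      have hne : V0 ≠ [] := fun h0 => by
        rw [h0, (hB 0).2] at hl0
        simp at hl0
      simp only [LocalKnots.supp, sub_self, Function.update_self]
      exact Set.Icc_subset_Icc ((hb 0).2.1 _ (hV0.subset (firstKnot_mem hne))).1
        ((hb 0).2.1 _ (hV0.subset (lastKnot_mem hne))).2
    obtain ⟨V1, hV1, hl1, hr1⟩ := exists_window_reach_of_insAll (M := tensorMesh lo hi h Ξ)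
      (k := 1) (B := Function.update B 0 V0) (hb 1).1 (e1 ▸ hΞD 1 ▸ (hB 1).1)
      (by rw [e1, (hB 1).2]; exact hlen 1) (hDlt 1) (hDgt 1)
      (by rw [e1, (hB 1).2]; exact hcount 1)
      (by
        intro c hc t ht
        have := hr00 ht
        simp only [tensorMesh, ← hΞD]
        rw [if_pos (by simpa using this)])
    refine ⟨_, ?_, hr1.trans hr0⟩
    intro k
    fin_cases k
    · exact ⟨hV0, hl0.trans (hB 0).2⟩
    · exact ⟨hV1, hl1.trans (hB 1).2⟩
  · rintro ⟨hmin, B0, hB0, hr⟩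
    have hreg := reg_of_mem_bern h hB0
    obtain ⟨W0, hW0, hl0, hreg0, hr0⟩ := exists_window_insAll_reach (D := D 0) (k := 0)
      (hb 0).1 hreg (hB0 0).1 (hmult _ hreg 0) hr hmin
    obtain ⟨W1, hW1, hl1, hreg1, hr1⟩ := exists_window_insAll_reach (D := D 1) (k := 1)
      (hb 1).1 hreg0 (hB0 1).1 (hmult _ hreg0 1) hr0 hmin
    have hmem : Function.update (Function.update B0 0 W0) 1 W1 ∈ tensorBSplines p Ξ := by
      intro k
      fin_cases k
      · exact ⟨hΞD 0 ▸ hW0, hl0.trans (hB0 0).2⟩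
      · exact ⟨hΞD 1 ▸ hW1, hl1.trans (hB0 1).2⟩
    rw [Reach.eq_of_minimalSupport hr1 (minimalSupport_tensor h hΞ hmem)]
    exact hmem

theorem Mesh.le_raise (M : Mesh) (k : Fin 2) (c u v : ℝ) (m : ℕ) (k' : Fin 2) (c' t : ℝ) :
    M.mult k' c' t ≤ (M.raise k c u v m).mult k' c' t := by
  simp only [Mesh.raise]
  split_ifs
  · exact le_max_left _ _
  · exact le_rfl

theorem Mesh.FinLines.raise {M : Mesh} {G : Finset ℝ} {n : ℕ} (h : M.FinLines G n) (k : Fin 2)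
    (c u v : ℝ) (m : ℕ) : (M.raise k c u v m).FinLines (insert c G) (max n m) := by
  intro k' c' t
  have := h k' c' t
  simp only [Mesh.raise]
  split_ifs with h'
  · exact ⟨max_le_max this.1 le_rfl, fun _ => by simp [h'.2.1]⟩
  · exact ⟨le_max_of_le_left this.1, fun h0 => Finset.mem_insert_of_mem (this.2 h0)⟩

theorem finLines_tensorMesh {p : Fin 2 → ℕ} {lo hi : Fin 2 → ℝ} (h : ∀ k, lo k < hi k)
    {Ξ : Fin 2 → List ℝ} (hΞ : ∀ k, IsOpenKnotVector (p k) (lo k) (hi k) (Ξ k)) :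
    (tensorMesh lo hi h Ξ).FinLines ((Ξ 0).toFinset ∪ (Ξ 1).toFinset) (p 0 + p 1 + 1) := by
  intro k c t
  simp only [tensorMesh]
  split_ifs with ht
  · constructor
    · refine ((hΞ k).2.2.2.2 c).trans ?_
      fin_cases k <;> simp
    · intro hc
      have hc := List.count_pos_iff.1 (Nat.pos_of_ne_zero hc)
      fin_cases k
      · simp at hc; simp [hc]
      · simp at hc; simp [hc]
  · simp

theorem IsLR.exists_finLines {p : Fin 2 → ℕ} {M : Mesh} {S : Set LocalKnots} (h : IsLR p M S) :
    ∃ G n, M.FinLines G n := by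
  induction h with
  | tensor lo hi h Ξ hΞ => exact ⟨_, _, finLines_tensorMesh h hΞ⟩
  | insert M S _ k c u v _ _ ih => exact let ⟨G, n, h⟩ := ih; ⟨_, _, h.raise k c u v 1⟩
  | increase M S _ k c u v _ _ m _ ih => exact let ⟨G, n, h⟩ := ih; ⟨_, _, h.raise k c u v m⟩

/-- The LR B-splines depend only on the mesh, not on its construction. -/
theorem IsLR.eq_refine {p : Fin 2 → ℕ} {M : Mesh} {S : Set LocalKnots} (h : IsLR p M S) :
    S = refine M (bern p M.lo M.hi) := by
  have step : ∀ (M : Mesh) (S : Set LocalKnots), IsLR p M S → ∀ k c u v m,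
      S = refine M (bern p M.lo M.hi) → refine (M.raise k c u v m) S =
      refine (M.raise k c u v m) (bern p (M.raise k c u v m).lo (M.raise k c u v m).hi) := by
    intro M S hM k c u v m hS
    obtain ⟨G, n, hG⟩ := hM.exists_finLines
    rw [hS]
    exact refine_refine hG (M.le_raise k c u v m) fun B hB => reg_of_mem_bern M.lo_lt_hi hB
  induction h with
  | tensor lo hi h Ξ hΞ => exact refine_tensor h hΞ
  | insert M S hM k c u v _ _ ih => exact step M S hM k c u v 1 ih
  | increase M S hM k c u v _ _ m _ ih => exact step M S hM k c u v m ih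

/-! ### Inflated knot vectors -/

/-- The knot vector in which all multiplicities are multiplied by `s + 1`. -/
def infl (s : ℕ) (L : List ℝ) : List ℝ := L.flatMap (List.replicate (s + 1))

theorem infl_cons (s : ℕ) (a : ℝ) (L : List ℝ) :
    infl s (a :: L) = List.replicate (s + 1) a ++ infl s L := rfl

theorem infl_append (s : ℕ) (L L' : List ℝ) : infl s (L ++ L') = infl s L ++ infl s L' :=
  List.flatMap_append

theorem length_infl (s : ℕ) (L : List ℝ) : (infl s L).length = (s + 1) * L.length := by
  induction L with
  | nil => rfl
  | cons a L ih => rw [infl_cons]; simp [ih]; ring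

theorem count_infl (s : ℕ) (L : List ℝ) (c : ℝ) : (infl s L).count c = (s + 1) * L.count c := by
  induction L with
  | nil => rfl
  | cons a L ih =>
    rw [infl_cons, List.count_append, ih, List.count_replicate, List.count_cons]
    split_ifs <;> ring

theorem mem_infl {s : ℕ} {L : List ℝ} {c : ℝ} : c ∈ infl s L ↔ c ∈ L := by
  simp [infl, List.mem_flatMap, List.mem_replicate]

theorem Srt.infl {L : List ℝ} (h : Srt L) (s : ℕ) : Srt (infl s L) := by
  induction L with
  | nil => exact List.Pairwise.nil
  | cons a L ih =>
    rw [infl_cons, Srt, List.pairwise_append]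
    refine ⟨by simp [List.pairwise_replicate], ih (List.pairwise_cons.1 h).2, fun x hx y hy => ?_⟩
    rw [List.eq_of_mem_replicate hx]
    exact (List.pairwise_cons.1 h).1 y (mem_infl.1 hy)

theorem infl_infix {L L' : List ℝ} (h : L <:+: L') (s : ℕ) : infl s L <:+: infl s L' := by
  obtain ⟨X, Y, rfl⟩ := h
  exact ⟨infl s X, infl s Y, by rw [infl_append, infl_append]⟩

theorem insAll_replicate_infl {L : List ℝ} (h : Srt L) (s : ℕ) (c : ℝ) :
    insAll (List.replicate (s + 1) c) (infl s L) = infl s (ins c L) := by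
  refine Srt.eq_of_perm ((h.infl s).insAll _) ((h.ins c).infl s) (List.perm_iff_count.2 fun a => ?_)
  rw [count_insAll, count_infl, count_infl, count_ins, List.count_replicate]
  simp only [beq_iff_eq]
  split_ifs <;> ring

/-- A window that starts at offset at most `s` in a block of `s + 1` equal entries ends at position
at most `s + (2s + 3) = 3s + 3`, that is, within the third block. -/
theorem exists_triple_of_window_infl {s : ℕ} {L W : List ℝ} (hW : W <:+: infl s L)
    (hl : W.length = 2 * s + 3) : ∃ T, T <:+: L ∧ T.length = 3 ∧ W <:+: infl s T := by
  induction L with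
  | nil =>
    have := hW.length_le
    simp [infl] at this
    simp [this] at hl
  | cons a L ih =>
    obtain ⟨X, Y, h⟩ := hW
    rw [infl_cons] at h
    by_cases hX : s + 1 ≤ X.length
    · rw [List.append_assoc, List.append_eq_append_iff] at h
      rcases h with ⟨E, h1, h2⟩ | ⟨E, h1, h2⟩
      · have h3 := congrArg List.length h1
        simp only [List.length_replicate, List.length_append] at h3
        have hE : E = [] := List.length_eq_zero_iff.1 (by omega)
        rw [hE] at h2
        obtain ⟨T, hT, h⟩ := ih ⟨[], Y, by simpa using h2⟩
        exact ⟨T, hT.trans (List.suffix_cons _ _).isInfix, h⟩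
      · obtain ⟨T, hT, h⟩ := ih ⟨E, Y, by rw [h2]; simp⟩
        exact ⟨T, hT.trans (List.suffix_cons _ _).isInfix, h⟩
    · push Not at hX
      have hlen : 3 ≤ (a :: L).length := by
        have h3 := congrArg List.length h
        rw [← infl_cons, length_infl] at h3
        simp only [List.length_append, hl] at h3
        by_contra hlt
        have : (s + 1) * (a :: L).length ≤ (s + 1) * 2 := Nat.mul_le_mul_left _ (by omega)
        omega
      refine ⟨(a :: L).take 3, (List.take_prefix _ _).isInfix, by simp at hlen ⊢; omega, ?_⟩
      rw [← infl_cons, ← List.take_append_drop 3 (a :: L), infl_append] at h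
      have h4 : (infl s ((a :: L).take 3)).length = 3 * s + 3 := by
        rw [length_infl, List.length_take, min_eq_left hlen]; ring
      have h5 : X ++ W <+: infl s ((a :: L).take 3) := by
        refine List.prefix_of_prefix_length_le ⟨Y, h⟩ ⟨_, rfl⟩ ?_
        simp only [List.length_append]
        omega
      exact (List.suffix_append X W).isInfix.trans h5.isInfix

/-- `r` is the offset of the window. It ranges from `0` to `s`, so the window contains the whole
middle block and at least one copy of each outer knot. -/
theorem window_infl_triple {s : ℕ} {a b c : ℝ} {W : List ℝ} (hW : W <:+: infl s [a, b, c])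
    (hl : W.length = 2 * s + 3) : ∃ r ≤ s, W = List.replicate (s + 1 - r) a ++
      (List.replicate (s + 1) b ++ List.replicate (r + 1) c) := by
  obtain ⟨X, Y, h⟩ := hW
  have h3 := congrArg List.length h
  rw [length_infl] at h3
  simp at h3
  refine ⟨X.length, by omega, ?_⟩
  have h4 : W = ((X ++ W ++ Y).drop X.length).take W.length := by simp
  rw [h4, h, hl]
  simp only [infl, List.flatMap_cons, List.flatMap_nil, List.append_nil, List.drop_append,
    List.take_append, List.drop_replicate, List.take_replicate, List.length_replicate]
  congr 1
  · congr 1; omega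
  · congr 1
    · congr 1; omega
    · congr 1; omega

theorem infix_infl_triple {s r : ℕ} (hr : r ≤ s) (a b c : ℝ) :
    List.replicate (s + 1 - r) a ++ (List.replicate (s + 1) b ++ List.replicate (r + 1) c) <:+:
      infl s [a, b, c] := by
  have ha : List.replicate (s + 1) a = List.replicate r a ++ List.replicate (s + 1 - r) a := by
    rw [List.replicate_append_replicate]; congr 1; omega
  have hc : List.replicate (s + 1) c = List.replicate (r + 1) c ++ List.replicate (s - r) c := by
    rw [List.replicate_append_replicate]; congr 1; omega
  refine ⟨List.replicate r a, List.replicate (s - r) c, ?_⟩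
  simp only [infl, List.flatMap_cons, List.flatMap_nil, List.append_nil]
  rw [ha, hc]
  simp only [List.append_assoc]

/-! ### The groups of B-splines associated with bilinear B-splines -/

/-- `B` is one of the `(s + 1) ^ 2` B-splines of bidegree `(2s + 1, 2s + 1)` that belong to the
bilinear B-spline `P`. -/
def Grp (s : ℕ) (P B : LocalKnots) : Prop :=
  ∀ k, B k <:+: infl s (P k) ∧ (B k).length = 2 * s + 3

/-- The bidegree `(d, d)`. -/
abbrev bideg (d : ℕ) : Fin 2 → ℕ := fun _ => d

theorem exists_triple_of_length {L : List ℝ} (h : L.length = 3) : ∃ a b c, L = [a, b, c] :=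
  List.length_eq_three.1 h

/-- Both outer blocks contribute at least one knot to every window, so a whole group shares one
support. -/
theorem Grp.first_last {s : ℕ} {lo hi} {P B : LocalKnots} (hP : Reg (bideg 1) lo hi P)
    (h : Grp s P B) (k : Fin 2) :
    firstKnot (B k) = firstKnot (P k) ∧ lastKnot (B k) = lastKnot (P k) := by
  obtain ⟨a, b, c, habc⟩ := exists_triple_of_length (hP.len k)
  obtain ⟨h1, h2⟩ := h k
  rw [habc] at h1 ⊢
  obtain ⟨r, hr, hW⟩ := window_infl_triple h1 h2
  rw [hW]
  constructor
  · rw [show s + 1 - r = (s - r) + 1 by omega, List.replicate_succ]; rfl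
  · rw [List.replicate_succ' (n := r), ← List.append_assoc, ← List.append_assoc,
      lastKnot_append_singleton]
    rfl

theorem Grp.reg {s : ℕ} {lo hi} {P B : LocalKnots} (hP : Reg (bideg 1) lo hi P)
    (h : Grp s P B) : Reg (bideg (2 * s + 1)) lo hi B where
  srt k := ((hP.srt k).infl s).infix (h k).1
  len k := (h k).2
  lt k := by rw [(h.first_last hP k).1, (h.first_last hP k).2]; exact hP.lt k
  lo_le k := by rw [(h.first_last hP k).1]; exact hP.lo_le k
  le_hi k := by rw [(h.first_last hP k).2]; exact hP.le_hi k

theorem Grp.supp_eq {s : ℕ} {lo hi} {P B : LocalKnots} (hP : Reg (bideg 1) lo hi P)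
    (h : Grp s P B) (k : Fin 2) : B.supp k = P.supp k := by
  rw [LocalKnots.supp, (h.first_last hP k).1, (h.first_last hP k).2, LocalKnots.supp]

theorem Grp.count_eq {s : ℕ} {lo hi} {P B : LocalKnots} (hP : Reg (bideg 1) lo hi P)
    (h : Grp s P B) {k : Fin 2} {c : ℝ} (h1 : firstKnot (P k) < c) (h2 : c < lastKnot (P k)) :
    (B k).count c = (s + 1) * (P k).count c := by
  rw [← count_infl]
  exact count_eq_of_infix ((hP.srt k).infl s) (h k).1 ((h.first_last hP k).1 ▸ h1)
    ((h.first_last hP k).2 ▸ h2)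

theorem exists_grp (s : ℕ) {lo hi} {P : LocalKnots} (hP : Reg (bideg 1) lo hi P) :
    ∃ B, Grp s P B := by
  choose a b c h using fun k => exists_triple_of_length (hP.len k)
  refine ⟨fun k => List.replicate (s + 1 - 0) (a k) ++
    (List.replicate (s + 1) (b k) ++ List.replicate (0 + 1) (c k)), fun k => ⟨?_, ?_⟩⟩
  · rw [h k]
    exact infix_infl_triple (Nat.zero_le s) _ _ _
  · simp; omega

theorem Mesh.setMult_mult_interior (M : Mesh) (mi mb : ℕ) {k : Fin 2} {c : ℝ}
    (h : c ∈ Set.Ioo (M.lo k) (M.hi k)) (t : ℝ) :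
    (M.setMult mi mb).mult k c t = if M.mult k c t = 0 then 0 else mi := by
  simp [Mesh.setMult, h.1.ne', h.2.ne]

theorem Mesh.FinLines.setMult {M : Mesh} {G : Finset ℝ} {n : ℕ} (h : M.FinLines G n)
    (mi mb : ℕ) : (M.setMult mi mb).FinLines G (max mi mb) := by
  intro k c t
  simp only [Mesh.setMult]
  split_ifs with h0 <;> simp [(h k c t).2, h0]

theorem Reg.mem_Ioo {p} {lo hi : Fin 2 → ℝ} {B} (hB : Reg p lo hi B) {k : Fin 2} {c : ℝ}
    (h1 : firstKnot (B k) < c) (h2 : c < lastKnot (B k)) : c ∈ Set.Ioo (lo k) (hi k) :=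
  ⟨(hB.lo_le k).trans_lt h1, h2.trans_le (hB.le_hi k)⟩

theorem Traverses.of_setMult_one {M : Mesh} {P : LocalKnots} (hP : Reg (bideg 1) M.lo M.hi P)
    {k : Fin 2} {c : ℝ} (h : Traverses (M.setMult 1 2) P k c) :
    (P k).count c = 0 ∧ ∀ t ∈ P.supp (1 - k), M.mult k c t ≠ 0 := by
  obtain ⟨h1, h2, h3⟩ := h
  simp only [M.setMult_mult_interior 1 2 (hP.mem_Ioo h1 h2)] at h3
  refine ⟨?_, fun t ht h0 => ?_⟩
  · have := h3 _ (hP.firstKnot_mem_supp _)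
    split_ifs at this
    · omega
    · exact Nat.lt_one_iff.1 this
  · have := h3 t ht
    simp [h0] at this

/-- Interior multiplicities of knots and of meshlines both carry the factor `s + 1`, which cancels.
Consequently minimal support of `P` passes to its group. -/
theorem Traverses.of_grp {s : ℕ} {M : Mesh} {P B : LocalKnots} (hP : Reg (bideg 1) M.lo M.hi P)
    (hB : Grp s P B) {k : Fin 2} {c : ℝ} (h : Traverses (M.setMult (s + 1) (2 * s + 2)) B k c) :
    Traverses (M.setMult 1 2) P k c := by
  obtain ⟨h1, h2, h3⟩ := h
  rw [(hB.first_last hP k).1] at h1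
  rw [(hB.first_last hP k).2] at h2
  refine ⟨h1, h2, fun t ht => ?_⟩
  have h3 := h3 t (by rwa [hB.supp_eq hP])
  rw [M.setMult_mult_interior _ _ (hP.mem_Ioo h1 h2), hB.count_eq hP h1 h2] at h3
  rw [M.setMult_mult_interior _ _ (hP.mem_Ioo h1 h2)]
  split_ifs at h3 ⊢ with h0
  · exact absurd h3 (Nat.not_lt_zero _)
  · exact Nat.lt_of_mul_lt_mul_left (a := s + 1) (by simpa using h3)

theorem count_insAll_replicate_infl {s : ℕ} {L : List ℝ} {c : ℝ} (h : L.count c = 0) :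
    ∀ c' ∈ List.replicate (s + 1) c,
      (insAll (List.replicate (s + 1) c) (infl s L)).count c' = s + 1 := by
  intro c' hc'
  rw [List.eq_of_mem_replicate hc', count_insAll, count_infl, h]
  simp

theorem le_setMult_of_traverses {s : ℕ} {M : Mesh} {P : LocalKnots}
    (hP : Reg (bideg 1) M.lo M.hi P) {k : Fin 2} {c : ℝ} (h : Traverses (M.setMult 1 2) P k c) :
    ∀ c' ∈ List.replicate (s + 1) c, ∀ t ∈ P.supp (1 - k),
      (insAll (List.replicate (s + 1) c) (infl s (P k))).count c' ≤
        (M.setMult (s + 1) (2 * s + 2)).mult k c' t := by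
  intro c' hc' t ht
  obtain ⟨h1, h2⟩ := h.of_setMult_one hP
  rw [count_insAll_replicate_infl h1 c' hc', List.eq_of_mem_replicate hc',
    M.setMult_mult_interior _ _ (hP.mem_Ioo h.1 h.2.1), if_neg (h2 t ht)]

/-- One bilinear split with knot `c` lifts to the insertion of `s + 1` copies of `c`, followed
backwards from a member of the group of the result. -/
theorem exists_grp_reach {s : ℕ} {M : Mesh} {P P' B' : LocalKnots}
    (hP : Reg (bideg 1) M.lo M.hi P) (h : Reach (M.setMult 1 2) P P') (hB' : Grp s P' B') :
    ∃ B, Grp s P B ∧ Reach (M.setMult (s + 1) (2 * s + 2)) B B' := by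
  induction h using Relation.ReflTransGen.head_induction_on with
  | refl => exact ⟨B', hB', .refl⟩
  | @head P P1 hstep hreach ih =>
    obtain ⟨B1, hB1, hr1⟩ := ih (hstep.reg hP)
    have hreg1 := hstep.reg hP
    obtain ⟨k, c, W, ht, hW, hl, rfl⟩ := splitsTo_iff.1 hstep
    have hne := ne_nil_of_first_lt_last (hP.lt k)
    have hsupp : B1.supp (1 - k) = P.supp (1 - k) := by
      rw [hB1.supp_eq hreg1, supp_update_of_ne (one_sub_ne k)]
    obtain ⟨V, hV, hVl, hVr⟩ := exists_window_reach_of_insAll (B := B1) (k := k)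
      (M := M.setMult (s + 1) (2 * s + 2)) (D := List.replicate (s + 1) c) ((hP.srt k).infl s)
      (by
        rw [insAll_replicate_infl (hP.srt k)]
        refine (hB1 k).1.trans (infl_infix ?_ s)
        simpa using hW)
      (by
        rw [(hB1 k).2, length_infl, hP.len k]
        change _ ≤ (s + 1) * (1 + 2)
        omega)
      (fun c' hc' => ⟨_, mem_infl.2 (firstKnot_mem hne), by
        rw [List.eq_of_mem_replicate hc']; exact ht.1⟩)
      (fun c' hc' => ⟨_, mem_infl.2 (lastKnot_mem hne), by
        rw [List.eq_of_mem_replicate hc']; exact ht.2.1⟩)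
      (fun c' hc' => by
        rw [count_insAll_replicate_infl (ht.of_setMult_one hP).1 c' hc', (hB1 k).2]; omega)
      (fun c' hc' t ht' => le_setMult_of_traverses hP ht c' hc' t (hsupp ▸ ht'))
    refine ⟨_, fun k' => ?_, hVr.trans hr1⟩
    by_cases hk : k' = k
    · subst hk
      rw [Function.update_self]
      exact ⟨hV, hVl.trans (hB1 k').2⟩
    · have := hB1 k'
      rwa [Function.update_of_ne hk] at this ⊢

/-- If `P` has minimal support, so has `B`, and nothing moves. Otherwise all `s + 1` copies of the
missing knot may be inserted first; the resulting window lies in an inflated triple, which is a half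
of `P`, and there is less room left. -/
theorem exists_reach_grp {s : ℕ} {M : Mesh} {G : Finset ℝ} {n : ℕ} (hM : M.FinLines G n)
    {P B B' : LocalKnots} (hP : Reg (bideg 1) M.lo M.hi P) (hB : Grp s P B)
    (h : Reach (M.setMult (s + 1) (2 * s + 2)) B B')
    (hmin : MinimalSupport (M.setMult (s + 1) (2 * s + 2)) B') :
    ∃ P', Reach (M.setMult 1 2) P P' ∧ MinimalSupport (M.setMult 1 2) P' ∧ Grp s P' B' := by
  induction hr : LocalKnots.room G (max 1 2) P using Nat.strong_induction_on generalizing P B with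
  | _ r ih =>
    by_cases hPm : MinimalSupport (M.setMult 1 2) P
    · rw [Reach.eq_of_minimalSupport h fun k c ht => hPm k c (ht.of_grp hP hB)]
      exact ⟨P, .refl, hPm, hB⟩
    · simp only [MinimalSupport, not_forall, not_not] at hPm
      obtain ⟨k, c, ht⟩ := hPm
      obtain ⟨W, hW, hl, hreg, hr'⟩ := exists_window_insAll_reach (k := k)
        (D := List.replicate (s + 1) c) ((hP.srt k).infl s) (hB.reg hP) (hB k).1
        (fun c' hc' t ht' => le_setMult_of_traverses hP ht c' hc' t (hB.supp_eq hP _ ▸ ht')) h hmin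
      rw [insAll_replicate_infl (hP.srt k)] at hW
      obtain ⟨T, hT, hTl, hWT⟩ := exists_triple_of_window_infl hW (hl.trans (hB k).2)
      have hTl' : T.length = (P k).length := hTl.trans (hP.len k).symm
      obtain ⟨P', h1, h2, h3⟩ := ih _ (hr ▸ room_update_lt (hM.setMult 1 2) hP ht hT hTl')
        (hP.update_ins ht.1 ht.2.1 hT hTl') (B := Function.update B k W) (fun k' => by
          by_cases hk : k' = k
          · subst hk
            rw [Function.update_self, Function.update_self]
            exact ⟨hWT, hl.trans (hB k').2⟩
          · rw [Function.update_of_ne hk, Function.update_of_ne hk]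
            exact hB k') hr' rfl
      exact ⟨P', .head (splitsTo_iff.2 ⟨k, c, T, ht, hT, hTl', rfl⟩) h1, h2, h3⟩

theorem bernKnots_eq_infl (s : ℕ) (lo hi : Fin 2 → ℝ) (k : Fin 2) :
    bernKnots (bideg (2 * s + 1)) lo hi k = infl s (bernKnots (bideg 1) lo hi k) := by
  simp only [bernKnots, infl_append, bideg]
  congr 1
  all_goals
    simp only [infl, List.replicate_succ (n := 1), List.replicate_one, List.flatMap_cons,
      List.flatMap_nil, List.append_nil, List.replicate_append_replicate]
    congr 1; omega

/-- The LR B-splines of bidegree `(2s + 1, 2s + 1)` on a mesh with internal multiplicities `s + 1`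
are given by the bilinear LR B-splines on the mesh with multiplicities one. -/
theorem mem_refine_iff_grp (s : ℕ) {M : Mesh} {G : Finset ℝ} {n : ℕ} (hM : M.FinLines G n)
    (B : LocalKnots) :
    B ∈ refine (M.setMult (s + 1) (2 * s + 2)) (bern (bideg (2 * s + 1)) M.lo M.hi) ↔
      ∃ P ∈ refine (M.setMult 1 2) (bern (bideg 1) M.lo M.hi), Grp s P B := by
  constructor
  · rintro ⟨hmin, B0, hB0, hr⟩
    have hex : ∀ k, ∃ T, T <:+: bernKnots (bideg 1) M.lo M.hi k ∧ T.length = 3 ∧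
        B0 k <:+: infl s T := fun k =>
      exists_triple_of_window_infl (bernKnots_eq_infl s M.lo M.hi k ▸ (hB0 k).1) (hB0 k).2
    choose P h1 h2 h3 using hex
    have hP : P ∈ bern (bideg 1) M.lo M.hi := fun k => ⟨h1 k, h2 k⟩
    obtain ⟨P', hP', hPm, hg⟩ := exists_reach_grp hM (reg_of_mem_bern M.lo_lt_hi hP)
      (fun k => ⟨h3 k, (hB0 k).2⟩) hr hmin
    exact ⟨P', ⟨hPm, P, hP, hP'⟩, hg⟩
  · rintro ⟨P, ⟨hPm, P0, hP0, hr⟩, hg⟩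
    have hreg0 := reg_of_mem_bern M.lo_lt_hi hP0
    obtain ⟨B0, hB0, hr'⟩ := exists_grp_reach hreg0 hr hg
    refine ⟨fun k c ht => hPm k c (ht.of_grp (Reach.reg hreg0 hr) hg), B0, fun k => ?_, hr'⟩
    exact ⟨bernKnots_eq_infl s M.lo M.hi k ▸ (hB0 k).1.trans (infl_infix (hP0 k).1 s), (hB0 k).2⟩

/-! ### Changing the multiplicities of an LR mesh -/

theorem firstKnot_dropLast_ins {L : List ℝ} {c : ℝ} (h1 : firstKnot L < c) (hne : L ≠ []) :
    firstKnot (ins c L).dropLast = firstKnot L := by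
  obtain ⟨a, l, rfl⟩ := List.exists_cons_of_ne_nil hne
  have hac : ¬ c ≤ a := not_le.2 h1
  have hl : ins c l ≠ [] := fun h => by
    have := length_ins c l
    rw [h] at this
    simp at this
  rw [ins, List.orderedInsert_of_not_le _ _ hac, List.dropLast_cons_of_ne_nil hl]
  rfl

theorem lastKnot_tail_ins {L : List ℝ} {c : ℝ} (hs : Srt L) (h1 : firstKnot L < c)
    (h2 : c < lastKnot L) : lastKnot (ins c L).tail = lastKnot L := by
  have hne := ne_nil_of_first_lt_last (h1.trans h2)
  refine le_antisymm (window_ins_bounds hs h1 h2 (List.tail_suffix _).isInfix ?_).2.1 ?_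
  · rw [List.length_tail, length_ins]; rfl
  · refine le_lastKnot ((hs.ins c).infix (List.tail_suffix _).isInfix) ?_
    have hl := lastKnot_mem hne
    obtain ⟨a, l, rfl⟩ := List.exists_cons_of_ne_nil hne
    have hac : ¬ c ≤ a := not_le.2 h1
    rw [ins, List.orderedInsert_of_not_le _ _ hac, List.tail_cons]
    rcases List.mem_cons.1 hl with hl | hl
    · rw [hl] at h2
      exact absurd (h1.trans h2) (lt_irrefl _)
    · exact mem_ins.2 (Or.inr hl)

/-- One of the two halves contains a given point in its support, and in the interior of
its support if the point is not the inserted knot. -/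
theorem exists_window_around {L : List ℝ} {c x : ℝ} (hs : Srt L) (h1 : firstKnot L < c)
    (h2 : c < lastKnot L) : ∃ W, W <:+: ins c L ∧ W.length = L.length ∧
      (firstKnot L ≤ x → x ≤ lastKnot L → firstKnot W ≤ x ∧ x ≤ lastKnot W) ∧
      (firstKnot L < x → x < lastKnot L → x ≠ c → firstKnot W < x ∧ x < lastKnot W) := by
  have hne := ne_nil_of_first_lt_last (h1.trans h2)
  have hl1 : (ins c L).dropLast.length = L.length := by
    rw [List.length_dropLast, length_ins]; rfl
  have hl2 : (ins c L).tail.length = L.length := by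
    rw [List.length_tail, length_ins]; rfl
  rcases le_total x c with hx | hx
  · have hW := (List.dropLast_prefix (ins c L)).isInfix
    obtain ⟨-, -, -, -, hc⟩ := window_ins_bounds hs h1 h2 hW hl1
    refine ⟨_, hW, hl1, ?_, ?_⟩ <;> rw [firstKnot_dropLast_ins h1 hne]
    · exact fun h _ => ⟨h, hx.trans hc⟩
    · exact fun h _ hxc => ⟨h, (lt_of_le_of_ne hx hxc).trans_le hc⟩
  · have hW := (List.tail_suffix (ins c L)).isInfix
    obtain ⟨-, -, -, hc, -⟩ := window_ins_bounds hs h1 h2 hW hl2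
    refine ⟨_, hW, hl2, ?_, ?_⟩ <;> rw [lastKnot_tail_ins hs h1 h2]
    · exact fun _ h => ⟨hc.trans hx, h⟩
    · exact fun _ h hxc => ⟨hc.trans_lt (lt_of_le_of_ne hx (Ne.symm hxc)), h⟩

/-- If the line at `c` is not part of the mesh at the point with other coordinate `t`, then
a B-spline around this point has a refinement with minimal support around this point. -/
theorem exists_minimalSupport_around {p lo hi} {M : Mesh} {G : Finset ℝ} {n : ℕ}
    (hM : M.FinLines G n) {B : LocalKnots} (hB : Reg p lo hi B) {k : Fin 2} {c t : ℝ}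
    (h0 : M.mult k c t = 0) (h1 : firstKnot (B k) < c) (h2 : c < lastKnot (B k))
    (hc : (B k).count c = 0) (ht : t ∈ B.supp (1 - k)) :
    ∃ B', Reach M B B' ∧ MinimalSupport M B' ∧ firstKnot (B' k) < c ∧ c < lastKnot (B' k) ∧
      (B' k).count c = 0 ∧ B'.supp (1 - k) ⊆ B.supp (1 - k) := by
  induction hr : LocalKnots.room G n B using Nat.strong_induction_on generalizing B with
  | _ r ih =>
    by_cases hm : MinimalSupport M B
    · exact ⟨B, .refl, hm, h1, h2, hc, subset_rfl⟩
    · simp only [MinimalSupport, not_forall, not_not] at hm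
      obtain ⟨k', c', htr⟩ := hm
      -- The half to follow is the one around the point with coordinate `c` in direction `k` and `t`
      -- in the other direction.
      obtain ⟨W, hW, hl, hW1, hW2⟩ := exists_window_around (x := if k' = k then c else t)
        (hB.srt k') htr.1 htr.2.1
      obtain ⟨b1, b2, b3, -⟩ := window_ins_bounds (hB.srt k') htr.1 htr.2.1 hW hl
      have hreg := hB.update_ins htr.1 htr.2.1 hW hl
      have hlt := hr ▸ room_update_lt hM hB htr hW hl
      have key : firstKnot (Function.update B k' W k) < c ∧
          c < lastKnot (Function.update B k' W k) ∧ (Function.update B k' W k).count c = 0 ∧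
          t ∈ LocalKnots.supp (Function.update B k' W) (1 - k) := by
        by_cases hk : k' = k
        · subst hk
          rw [supp_update_of_ne (one_sub_ne k')]
          simp only [Function.update_self]
          -- A line at `c` cannot traverse the support, since it is absent at `t`.
          have hcc : c ≠ c' := by
            rintro rfl
            have := htr.2.2 t ht
            omega
          simp only [if_true] at hW2
          refine ⟨(hW2 h1 h2 hcc).1, (hW2 h1 h2 hcc).2, ?_, ht⟩
          have := hW.sublist.count_le c
          rw [count_ins_of_ne hcc] at this
          omega
        · rw [Function.update_of_ne (Ne.symm hk)]
          refine ⟨h1, h2, hc, ?_⟩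
          have hk' := eq_one_sub hk
          subst hk'
          simp only [if_neg hk] at hW1
          rw [LocalKnots.supp, Function.update_self]
          exact hW1 ht.1 ht.2
      obtain ⟨B', a1, a2, a3, a4, a5, a6⟩ := ih _ hlt hreg key.1 key.2.1 key.2.2.1 key.2.2.2 rfl
      exact ⟨B', .head (splitsTo_iff.2 ⟨k', c', W, htr, hW, hl, rfl⟩) a1, a2, a3, a4, a5,
        a6.trans (supp_update_subset b1 b2 _)⟩

/-! ### Replaying the construction of an LR mesh for another bidegree -/

theorem setMult_tensorMesh {p : Fin 2 → ℕ} {lo hi : Fin 2 → ℝ} (h : ∀ k, lo k < hi k)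
    {Ξ : Fin 2 → List ℝ} (hΞ : ∀ k, IsOpenKnotVector (p k) (lo k) (hi k) (Ξ k)) (s : ℕ) :
    ∃ Ξ' : Fin 2 → List ℝ,
      (∀ k, IsOpenKnotVector (bideg (2 * s + 1) k) (lo k) (hi k) (Ξ' k)) ∧
      (tensorMesh lo hi h Ξ).setMult (s + 1) (2 * s + 2) = tensorMesh lo hi h Ξ' := by
  -- The extra copies of the boundary knots make them occur twice before inflation, hence `2s + 2`
  -- times after it; internal knots occur `s + 1` times.
  set Ξ' : Fin 2 → List ℝ := fun k => infl s (lo k :: ((Ξ k).dedup ++ [hi k])) with hΞ'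
  have hcount : ∀ k c, (Ξ' k).count c = if (Ξ k).count c = 0 then 0 else
      if c = lo k ∨ c = hi k then 2 * s + 2 else s + 1 := by
    intro k c
    have hlo : lo k ∈ Ξ k := List.count_pos_iff.1 (by rw [(hΞ k).2.2.1]; omega)
    have hhi : hi k ∈ Ξ k := List.count_pos_iff.1 (by rw [(hΞ k).2.2.2.1]; omega)
    have hne := h k
    simp only [hΞ', count_infl, List.count_cons, List.count_append, List.count_dedup,
      List.count_nil, beq_iff_eq, List.count_eq_zero]
    by_cases h1 : c = lo k
    · subst h1; simp [hlo, hne.ne']; ring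
    · by_cases h2 : c = hi k
      · subst h2; simp [hhi, hne.ne]; ring
      · by_cases h3 : c ∈ Ξ k <;> simp [h1, h2, h3, Ne.symm h1, Ne.symm h2]
  refine ⟨Ξ', fun k => ⟨?_, ?_, ?_, ?_, ?_⟩, ?_⟩
  · refine Srt.infl ?_ s
    have hd : Srt (Ξ k).dedup := List.Pairwise.sublist (List.dedup_sublist _) (hΞ k).1
    refine List.pairwise_cons.2 ⟨?_, List.pairwise_append.2 ⟨hd, by simp, ?_⟩⟩
    · intro x hx
      simp only [List.mem_append, List.mem_dedup, List.mem_singleton] at hx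
      rcases hx with hx | rfl
      · exact ((hΞ k).2.1 x hx).1
      · exact (h k).le
    · intro x hx y hy
      rw [List.mem_singleton.1 hy]
      exact ((hΞ k).2.1 x (List.mem_dedup.1 hx)).2
  · intro c hc
    rw [mem_infl] at hc
    simp only [List.mem_cons, List.mem_append, List.mem_dedup, List.not_mem_nil, or_false] at hc
    rcases hc with rfl | hc | rfl
    · exact ⟨le_rfl, (h k).le⟩
    · exact (hΞ k).2.1 c hc
    · exact ⟨(h k).le, le_rfl⟩
  · rw [hcount, (hΞ k).2.2.1]; simp
  · rw [hcount, (hΞ k).2.2.2.1]; simp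
  · intro c
    rw [hcount]
    simp only [bideg]
    split_ifs <;> omega
  · ext1 <;> try rfl
    funext k c t
    simp only [Mesh.setMult, tensorMesh, hcount]
    split_ifs <;> simp_all

/-- The multiplicities are at most `s + 1` inside and at most `2s + 2` on the boundary. -/
def Mesh.MultLE (s : ℕ) (M : Mesh) : Prop :=
  ∀ k c t, M.mult k c t ≤ (M.setMult (s + 1) (2 * s + 2)).mult k c t

theorem Mesh.MultLE.of_raise {s : ℕ} {M : Mesh} {k : Fin 2} {c u v : ℝ} {m : ℕ}
    (h : (M.raise k c u v m).MultLE s) : M.MultLE s := by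
  intro k' c' t
  have h1 := h k' c' t
  have h2 := M.le_raise k c u v m k' c' t
  simp only [Mesh.setMult] at h1 ⊢
  by_cases h0 : M.mult k' c' t = 0
  · simp [h0]
  · rw [if_neg h0]
    rw [if_neg (by omega)] at h1
    exact h2.trans h1

theorem Mesh.raise_mult_of_mem (M : Mesh) {k : Fin 2} {c u v t : ℝ} (m : ℕ)
    (ht : t ∈ Set.Icc u v) : (M.raise k c u v m).mult k c t = max (M.mult k c t) m :=
  if_pos ⟨rfl, rfl, ht⟩

theorem Mesh.raise_mult_of_not (M : Mesh) {k k' : Fin 2} {c c' u v t : ℝ} (m : ℕ)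
    (h : ¬ (k' = k ∧ c' = c ∧ t ∈ Set.Icc u v)) :
    (M.raise k c u v m).mult k' c' t = M.mult k' c' t :=
  if_neg h

theorem Mesh.setMult_mult (M : Mesh) (mi mb : ℕ) (k : Fin 2) (c t : ℝ) :
    (M.setMult mi mb).mult k c t =
      if M.mult k c t = 0 then 0 else if c = M.lo k ∨ c = M.hi k then mb else mi := rfl

/-- Raising the multiplicity of existing lines is invisible after all multiplicities are reset, so
these steps disappear from the replayed construction. -/
theorem setMult_raise_of_pos {M : Mesh} {k : Fin 2} {c u v : ℝ} {m : ℕ}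
    (h : ∀ t ∈ Set.Icc u v, 0 < M.mult k c t) (mi mb : ℕ) :
    (M.raise k c u v m).setMult mi mb = M.setMult mi mb := by
  ext1 <;> try rfl
  funext k' c' t
  rw [Mesh.setMult_mult, Mesh.setMult_mult]
  by_cases h' : k' = k ∧ c' = c ∧ t ∈ Set.Icc u v
  · obtain ⟨rfl, rfl, ht⟩ := h'
    have := h t ht
    rw [M.raise_mult_of_mem m ht, if_neg (show ¬ max (M.mult k' c' t) m = 0 by omega),
      if_neg (show ¬ M.mult k' c' t = 0 by omega)]
    rfl
  · rw [M.raise_mult_of_not m h']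
    rfl

/-- One insertion in the old construction corresponds to two steps in the new one: insertion with
multiplicity one, then increase. Parts of the segment already in the mesh have the full
multiplicity, so the maxima do not change them. -/
theorem raise_raise_setMult {M : Mesh} {k : Fin 2} {c u v : ℝ}
    (hc : c ∈ Set.Ioo (M.lo k) (M.hi k)) (mi mb : ℕ) :
    (((M.setMult (mi + 1) mb).raise k c u v 1).raise k c u v (mi + 1)) =
      (M.raise k c u v 1).setMult (mi + 1) mb := by
  ext1 <;> try rfl
  funext k' c' t
  by_cases h' : k' = k ∧ c' = c ∧ t ∈ Set.Icc u v
  · obtain ⟨rfl, rfl, ht⟩ := h'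
    rw [Mesh.raise_mult_of_mem _ _ ht, Mesh.raise_mult_of_mem _ _ ht,
      M.setMult_mult_interior _ _ hc,
      (M.raise k' c' u v 1).setMult_mult_interior _ _ (k := k') hc,
      Mesh.raise_mult_of_mem _ _ ht, if_neg (show ¬ max (M.mult k' c' t) 1 = 0 by omega)]
    split_ifs <;> simp
  · rw [Mesh.raise_mult_of_not _ _ h', Mesh.raise_mult_of_not _ _ h', Mesh.setMult_mult,
      Mesh.setMult_mult, Mesh.raise_mult_of_not _ _ h']
    rfl

theorem Mesh.IsInternalSegment.of_mult {M M' : Mesh} {k : Fin 2} {c u v : ℝ}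
    (h : M.IsInternalSegment k c u v) (hlo : M'.lo = M.lo) (hhi : M'.hi = M.hi)
    (hm : ∀ k c t, 0 < M.mult k c t → 0 < M'.mult k c t) : M'.IsInternalSegment k c u v := by
  unfold Mesh.IsInternalSegment at *
  rw [hlo, hhi]
  exact ⟨h.1, h.2.1, h.2.2.1, h.2.2.2.1, hm _ _ _ h.2.2.2.2.1, hm _ _ _ h.2.2.2.2.2⟩

theorem Mesh.setMult_pos {M : Mesh} {mi mb : ℕ} (hi : 0 < mi) (hb : 0 < mb) {k : Fin 2} {c t : ℝ}
    (h : 0 < M.mult k c t) : 0 < (M.setMult mi mb).mult k c t := by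
  simp only [Mesh.setMult, if_neg h.ne']
  split_ifs <;> assumption

/-- The traversal condition for the insertion of a meshline does not depend on the
bidegree. -/
theorem exists_traverses_setMult {s s' : ℕ} {M : Mesh} {S S' : Set LocalKnots} {k : Fin 2}
    {c u v : ℝ} (hS : IsLR (bideg (2 * s + 1)) M S)
    (hS' : IsLR (bideg (2 * s' + 1)) (M.setMult (s' + 1) (2 * s' + 2)) S') (hle : M.MultLE s)
    (htrav : ∃ B ∈ S, Traverses (M.raise k c u v 1) B k c) :
    ∃ B ∈ S', Traverses ((M.setMult (s' + 1) (2 * s' + 2)).raise k c u v 1) B k c := by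
  obtain ⟨B, hBS, h1, h2, h3⟩ := htrav
  obtain ⟨G, n, hG⟩ := hS.exists_finLines
  have hregS : ∀ B ∈ S, MinimalSupport M B ∧ Reg (bideg (2 * s + 1)) M.lo M.hi B := by
    intro B hB
    rw [hS.eq_refine] at hB
    obtain ⟨hmin, B0, hB0, hr⟩ := hB
    exact ⟨hmin, Reach.reg (reg_of_mem_bern M.lo_lt_hi hB0) hr⟩
  obtain ⟨hmin, hreg⟩ := hregS B hBS
  -- `B` had minimal support before the insertion, so the old mesh fails to exceed the knot count at
  -- some `t`; as the new line has multiplicity one, both numbers are zero there.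
  obtain ⟨t, ht, htc⟩ : ∃ t ∈ B.supp (1 - k), M.mult k c t ≤ (B k).count c := by
    by_contra hcon
    push Not at hcon
    exact hmin k c ⟨h1, h2, hcon⟩
  have hzero : (B k).count c = 0 ∧ M.mult k c t = 0 := by
    have := h3 t ht
    simp only [Mesh.raise, true_and] at this
    split_ifs at this <;> omega
  -- The old intermediate mesh may have multiplicities below `s + 1`, for which there are no groups.
  -- Refining `B` to full multiplicity around the gap at `t` gives a B-spline that belongs to a
  -- group and is still traversed by the new line.
  obtain ⟨B1, hr1, hm1, a1, a2, a3, a4⟩ := exists_minimalSupport_around (k := k) (c := c) (t := t)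
    (hG.setMult (s + 1) (2 * s + 2)) hreg (by simp [Mesh.setMult, hzero.2]) h1 h2 hzero.1 ht
  have hB1 : B1 ∈ refine (M.setMult (s + 1) (2 * s + 2)) (bern (bideg (2 * s + 1)) M.lo M.hi) := by
    rw [← refine_refine hG hle fun B hB => reg_of_mem_bern M.lo_lt_hi hB, ← hS.eq_refine]
    exact ⟨hm1, B, hBS, hr1⟩
  obtain ⟨P, hP, hPB1⟩ := (mem_refine_iff_grp s hG B1).1 hB1
  have hPreg : Reg (bideg 1) M.lo M.hi P :=
    let ⟨_, _, hP0, hr⟩ := hP; Reach.reg (reg_of_mem_bern M.lo_lt_hi hP0) hr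
  obtain ⟨B', hB'⟩ := exists_grp s' hPreg
  rw [(hPB1.first_last hPreg k).1] at a1
  rw [(hPB1.first_last hPreg k).2] at a2
  have hcount : (P k).count c = 0 := by
    rw [hPB1.count_eq hPreg a1 a2] at a3
    simpa using a3
  refine ⟨B', ?_, ?_, ?_, ?_⟩
  · rw [hS'.eq_refine]
    exact (mem_refine_iff_grp s' hG B').2 ⟨P, hP, hB'⟩
  · rwa [(hB'.first_last hPreg k).1]
  · rwa [(hB'.first_last hPreg k).2]
  · intro τ hτ
    rw [hB'.supp_eq hPreg, ← hPB1.supp_eq hPreg] at hτ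
    rw [hB'.count_eq hPreg a1 a2, hcount, mul_zero]
    have h3 := h3 τ (a4 hτ)
    simp only [Mesh.raise, true_and] at h3 ⊢
    split_ifs at h3 ⊢
    · simp
    -- Outside the inserted segment the line was already in the mesh.
    · exact Mesh.setMult_pos (by omega) (by omega) (by omega)

/-- Multiplicities only grow during a construction, so the bound `MultLE` on the final mesh is
inherited by all intermediate ones and can be carried through the induction. -/
theorem IsLR.setMult {s : ℕ} (s' : ℕ) {M : Mesh} {S : Set LocalKnots}
    (h : IsLR (bideg (2 * s + 1)) M S) (hle : M.MultLE s) :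
    ∃ S', IsLR (bideg (2 * s' + 1)) (M.setMult (s' + 1) (2 * s' + 2)) S' := by
  induction h with
  | tensor lo hi h Ξ hΞ =>
    obtain ⟨Ξ', hΞ', heq⟩ := setMult_tensorMesh h hΞ s'
    rw [heq]
    exact ⟨_, .tensor lo hi h Ξ' hΞ'⟩
  | increase M S hM k c u v hseg hexist m hm ih =>
    rw [setMult_raise_of_pos hexist]
    exact ih hle.of_raise
  | insert M S hM k c u v hseg htrav ih =>
    obtain ⟨S', hS'⟩ := ih hle.of_raise
    rw [← raise_raise_setMult hseg.1]
    have hseg' := hseg.of_mult (M' := M.setMult (s' + 1) (2 * s' + 2)) rfl rfl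
      fun k c t => Mesh.setMult_pos (by omega) (by omega)
    refine ⟨_, .increase _ _ (.insert _ _ hS' k c u v hseg'
      (exists_traverses_setMult hM hS' hle.of_raise htrav)) k c u v
      (hseg'.of_mult rfl rfl fun k' c' t h => h.trans_le (Mesh.le_raise _ _ _ _ _ _ _ _ _)) ?_ _ ?_⟩
    · intro t ht
      rw [Mesh.raise_mult_of_mem _ _ ht]
      omega
    · simp only [bideg]; omega

/-- The boundary clause of admissibility only speaks of points in the domain; this excludes stray
lines elsewhere and is what `AdmissibleRM.setMult_eq` needs. -/
theorem IsLR.mult_ne_zero {p : Fin 2 → ℕ} {M : Mesh} {S : Set LocalKnots} (h : IsLR p M S)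
    {k : Fin 2} {c t : ℝ} (hne : M.mult k c t ≠ 0) :
    c ∈ Set.Icc (M.lo k) (M.hi k) ∧ t ∈ Set.Icc (M.lo (1 - k)) (M.hi (1 - k)) := by
  have step : ∀ (M : Mesh) k' c' u v m, M.IsInternalSegment k' c' u v →
      (∀ {k c t}, M.mult k c t ≠ 0 →
        c ∈ Set.Icc (M.lo k) (M.hi k) ∧ t ∈ Set.Icc (M.lo (1 - k)) (M.hi (1 - k))) →
      ∀ {k c t}, (M.raise k' c' u v m).mult k c t ≠ 0 →
        c ∈ Set.Icc (M.lo k) (M.hi k) ∧ t ∈ Set.Icc (M.lo (1 - k)) (M.hi (1 - k)) := by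
    intro M k' c' u v m hseg ih k c t hne
    simp only [Mesh.raise] at hne
    split_ifs at hne with h
    · obtain ⟨rfl, rfl, ht⟩ := h
      exact ⟨Set.Ioo_subset_Icc_self hseg.1,
        hseg.2.2.1.1.trans ht.1, ht.2.trans hseg.2.2.2.1.2⟩
    · exact ih hne
  induction h generalizing k c t with
  | tensor lo hi h Ξ hΞ =>
    simp only [tensorMesh] at hne ⊢
    split_ifs at hne with ht
    · exact ⟨(hΞ k).2.1 c (List.count_pos_iff.1 (Nat.pos_of_ne_zero hne)), ht⟩
    · exact absurd rfl hne
  | increase M S hM k c u v hseg _ m _ ih => exact step M _ _ _ _ _ hseg ih hne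
  | insert M S hM k c u v hseg _ ih => exact step M _ _ _ _ _ hseg ih hne

theorem AdmissibleRM.setMult_eq {s : ℕ} {M : Mesh} (h : AdmissibleRM s M) :
    M.setMult (s + 1) (2 * s + 2) = M := by
  obtain ⟨S, hS⟩ := h.isLR
  ext1 <;> try rfl
  funext k c t
  simp only [Mesh.setMult]
  by_cases h0 : M.mult k c t = 0
  · rw [if_pos h0, h0]
  · rw [if_neg h0]
    obtain ⟨hc, ht⟩ := hS.mult_ne_zero h0
    by_cases hb : c = M.lo k ∨ c = M.hi k
    · rw [if_pos hb, h.boundary k c hb t ht]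
    · rw [if_neg hb]
      push Not at hb
      exact (h.internal k c ⟨lt_of_le_of_ne hc.1 (Ne.symm hb.1), lt_of_le_of_ne hc.2 hb.2⟩ t h0).symm

/-! ### Univariate B-splines -/

theorem exists_cons_append_of_two_le {L : List ℝ} (h : 2 ≤ L.length) :
    ∃ a m b, L = a :: (m ++ [b]) := by
  obtain ⟨a, l, rfl⟩ := List.exists_cons_of_ne_nil (l := L) (by rintro rfl; simp at h)
  rcases List.eq_nil_or_concat l with rfl | ⟨m, b, rfl⟩
  · simp at h
  · exact ⟨a, m, b, by simp⟩

theorem bspline_succ {p : ℕ} {L Ld Lt : List ℝ} (hd : L.dropLast = Ld) (ht : L.tail = Lt)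
    {a q d e : ℝ} (ha : firstKnot L = a) (hq : lastKnot Ld = q) (hd' : firstKnot Lt = d)
    (he : lastKnot L = e) (x : ℝ) :
    bspline (p + 1) L x =
      (x - a) / (q - a) * bspline p Ld x + (e - x) / (e - d) * bspline p Lt x := by
  subst hd ht ha hq hd' he
  rfl

theorem dropLast_cons_append_singleton (a b : ℝ) (m : List ℝ) :
    (a :: (m ++ [b])).dropLast = a :: m := by
  rw [← List.cons_append, List.dropLast_concat]

theorem bspline_eq_zero {p : ℕ} {L : List ℝ} (hs : Srt L) (hl : L.length = p + 2) {x : ℝ}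
    (hx : ¬ (firstKnot L ≤ x ∧ x < lastKnot L)) : bspline p L x = 0 := by
  induction p generalizing L with
  | zero => simp [bspline, hx]
  | succ p ih =>
    have hd : L.dropLast.length = p + 2 := by rw [List.length_dropLast, hl]; rfl
    have ht : L.tail.length = p + 2 := by rw [List.length_tail, hl]; rfl
    have hid := (List.dropLast_prefix L).isInfix
    have hit := (List.tail_suffix L).isInfix
    have hdn : L.dropLast ≠ [] := fun h => by rw [h] at hd; simp at hd
    have htn : L.tail ≠ [] := fun h => by rw [h] at ht; simp at ht
    have key : ∀ V, V <:+: L → V ≠ [] → ¬ (firstKnot V ≤ x ∧ x < lastKnot V) := by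
      intro V hV hne h
      exact hx ⟨(firstKnot_le hs (hV.subset (firstKnot_mem hne))).trans h.1,
        h.2.trans_le (le_lastKnot hs (hV.subset (lastKnot_mem hne)))⟩
    rw [bspline, ih (hs.infix hid) hd (key _ hid hdn), ih (hs.infix hit) ht (key _ hit htn)]
    simp

/-- Each term of the recursion is positive when `x` is interior to the corresponding half and zero
otherwise. If both vanished, `x` would equal a knot of the middle part. -/
theorem bspline_pos {p : ℕ} {L : List ℝ} (hs : Srt L) (hl : L.length = p + 2) {x : ℝ}
    (hxL : x ∉ L) (h1 : firstKnot L < x) (h2 : x < lastKnot L) : 0 < bspline p L x := by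
  induction p generalizing L with
  | zero => simp [bspline, h1.le, h2]
  | succ p ih =>
    obtain ⟨a, m, b, rfl⟩ := exists_cons_append_of_two_le (L := L) (by omega)
    have hdl := dropLast_cons_append_singleton a b m
    have hm : m ≠ [] := by
      rintro rfl
      simp at hl
    have hlast : lastKnot (a :: m) = lastKnot m := lastKnot_append (L := [a]) hm
    have hfirst : firstKnot (m ++ [b]) = firstKnot m := firstKnot_append hm
    have hlb : lastKnot (a :: (m ++ [b])) = b := lastKnot_append_singleton b (a :: m)
    rw [hlb] at h2
    rw [firstKnot_cons] at h1
    rw [bspline_succ (Lt := m ++ [b]) (a := a) hdl rfl rfl hlast hfirst hlb]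
    have hsd : Srt (a :: m) := hs.infix (hdl ▸ (List.dropLast_prefix _).isInfix)
    have hst : Srt (m ++ [b]) := hs.infix (List.suffix_cons _ _).isInfix
    have hld : (a :: m).length = p + 2 := by simp at hl ⊢; omega
    have hlt : (m ++ [b]).length = p + 2 := by simp at hl ⊢; omega
    have hxd : x ∉ a :: m := fun h => hxL (by
      rw [← List.cons_append]; exact List.mem_append_left _ h)
    have hxt : x ∉ m ++ [b] := fun h => hxL (List.mem_cons_of_mem _ h)
    have hpd : x < lastKnot m → 0 < (x - a) / (lastKnot m - a) * bspline p (a :: m) x := by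
      intro h
      exact mul_pos (div_pos (by linarith) (by linarith))
        (ih hsd hld hxd h1 (by rwa [hlast]))
    have hpt : firstKnot m < x →
        0 < (b - x) / (b - firstKnot m) * bspline p (m ++ [b]) x := by
      intro h
      exact mul_pos (div_pos (by linarith) (by linarith))
        (ih hst hlt hxt (by rwa [hfirst]) (by rwa [lastKnot_append_singleton]))
    have hzd : ¬ x < lastKnot m → bspline p (a :: m) x = 0 := fun h =>
      bspline_eq_zero hsd hld (by rw [hlast]; tauto)
    have hzt : ¬ firstKnot m < x → bspline p (m ++ [b]) x = 0 := fun h => by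
      refine bspline_eq_zero hst hlt ?_
      rw [hfirst]
      rintro ⟨h3, -⟩
      have : x = firstKnot m := le_antisymm (not_lt.1 h) h3
      exact hxt (this ▸ List.mem_append_left _ (firstKnot_mem hm))
    by_cases c1 : x < lastKnot m <;> by_cases c2 : firstKnot m < x
    · exact add_pos (hpd c1) (hpt c2)
    · rw [hzt c2, mul_zero, add_zero]; exact hpd c1
    · rw [hzd c1, mul_zero, zero_add]; exact hpt c2
    · have h3 : firstKnot m ≤ lastKnot m :=
        firstKnot_le (hsd.infix (List.suffix_cons _ _).isInfix) (lastKnot_mem hm)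
      have h4 : x = firstKnot m := le_antisymm (not_lt.1 c2) (h3.trans (not_lt.1 c1))
      exact absurd (h4 ▸ List.mem_append_left _ (firstKnot_mem hm)) hxt

/-- Knot insertion. -/
theorem bspline_knot_insertion {p : ℕ} {X Y : List ℝ} {c : ℝ} (hX : X ≠ []) (hY : Y ≠ [])
    (hs : Srt (X ++ c :: Y)) (hl : X.length + Y.length = p + 2) (x : ℝ) :
    bspline p (X ++ Y) x =
      (c - firstKnot X) / (lastKnot (X ++ c :: Y).dropLast - firstKnot X) *
        bspline p (X ++ c :: Y).dropLast x +
      (lastKnot Y - c) / (lastKnot Y - firstKnot (X ++ c :: Y).tail) *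
        bspline p (X ++ c :: Y).tail x := by
  induction p generalizing X Y with
  | zero =>
    have h1 := List.length_pos_iff.2 hX
    have h2 := List.length_pos_iff.2 hY
    obtain ⟨a, rfl⟩ := List.length_eq_one_iff.1 (show X.length = 1 by omega)
    obtain ⟨e, rfl⟩ := List.length_eq_one_iff.1 (show Y.length = 1 by omega)
    simp only [List.singleton_append, Srt, List.pairwise_cons] at hs
    have hac : a ≤ c := hs.1 c (by simp)
    have hce : c ≤ e := hs.2.1 e (by simp)
    simp only [bspline, firstKnot, lastKnot, List.singleton_append, List.headD_cons,
      List.dropLast, List.tail_cons, List.getLastD_cons, List.getLastD_nil]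
    rcases eq_or_lt_of_le hac with rfl | hac
    · rcases eq_or_lt_of_le hce with rfl | hce
      · simp
      · rw [div_self (by linarith : e - a ≠ 0)]
        simp
    · rw [div_self (by linarith : c - a ≠ 0)]
      rcases eq_or_lt_of_le hce with rfl | hce
      · simp
      · rw [div_self (by linarith : e - c ≠ 0)]
        by_cases h1 : a ≤ x <;> by_cases h2 : x < c <;> by_cases h3 : x < e <;>
          by_cases h4 : c ≤ x <;> simp [h1, h2, h3, h4] <;> linarith
  | succ p ih =>
    obtain ⟨a, X', rfl⟩ := List.exists_cons_of_ne_nil hX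
    obtain ⟨Y', e, rfl⟩ : ∃ Y' e, Y = Y' ++ [e] := by
      rcases List.eq_nil_or_concat Y with rfl | ⟨l, b, rfl⟩
      · exact absurd rfl hY
      · exact ⟨l, b, by simp⟩
    have hmid : Srt (X' ++ c :: Y') := hs.infix ⟨[a], [e], by simp⟩
    have hsd : Srt (a :: X' ++ c :: Y') := hs.infix ⟨[], [e], by simp⟩
    have hst : Srt (X' ++ c :: (Y' ++ [e])) := hs.infix ⟨[a], [], by simp⟩
    have hlm : (X' ++ c :: Y').length = p + 2 := by simp at hl ⊢; omega
    have hdl : (a :: X' ++ c :: (Y' ++ [e])).dropLast = a :: X' ++ c :: Y' := by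
      rw [show a :: X' ++ c :: (Y' ++ [e]) = (a :: X' ++ c :: Y') ++ [e] by simp,
        List.dropLast_concat]
    have htl : (a :: X' ++ c :: (Y' ++ [e])).tail = X' ++ c :: (Y' ++ [e]) := rfl
    have hae : a ≤ c ∧ c ≤ e := by
      rw [Srt, List.pairwise_append] at hs
      refine ⟨hs.2.2 a (by simp) c (by simp), (List.pairwise_cons.1 hs.2.1).1 e (by simp)⟩
    set q := lastKnot (a :: X' ++ c :: Y').dropLast with hq
    set b := lastKnot (c :: Y') with hb
    set d := firstKnot (X' ++ [c]) with hd
    set r := firstKnot (X' ++ c :: (Y' ++ [e])).tail with hr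
    have hbl : ∀ Z, lastKnot (Z ++ c :: Y') = b := fun Z => lastKnot_append (by simp)
    have hdf : ∀ Z, firstKnot (X' ++ c :: Z) = d := fun Z => by
      rw [show X' ++ c :: Z = (X' ++ [c]) ++ Z by simp, firstKnot_append (by simp)]
    have hel : ∀ Z : List ℝ, lastKnot (Z ++ [e]) = e := fun Z => lastKnot_append_singleton e Z
    have hdc : d ≤ c := by
      rw [← hdf Y']; exact firstKnot_le hmid (by simp)
    have hcb : c ≤ b := by
      rw [← hbl X']; exact le_lastKnot hmid (by simp)
    have had : a ≤ d := by
      have : d ∈ a :: X' ++ c :: Y' := by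
        rw [← hdf Y']
        exact List.mem_cons_of_mem _ (firstKnot_mem (by simp))
      exact firstKnot_le hsd this
    have hbe : b ≤ e := by
      have h1 : b ∈ X' ++ c :: (Y' ++ [e]) := by
        rw [← hbl X']
        have := lastKnot_mem (L := X' ++ c :: Y') (by simp)
        simp only [List.mem_append, List.mem_cons] at this ⊢
        tauto
      have := le_lastKnot hst h1
      rwa [show X' ++ c :: (Y' ++ [e]) = (X' ++ c :: Y') ++ [e] by simp, hel] at this
    set Nm := bspline p (X' ++ c :: Y') x with hNm
    set N1 := bspline p (a :: X' ++ c :: Y').dropLast x with hN1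
    set N3 := bspline p (X' ++ c :: (Y' ++ [e])).tail x with hN3
    -- When the two halves share a degenerate middle spline, that spline vanishes; this is what
    -- makes the convention on zero denominators consistent with the formula.
    have hNm0 : b = d → Nm = 0 := fun h =>
      bspline_eq_zero hmid hlm (by rw [hbl, hdf, h]; intro h; linarith)
    have hdlast : bspline (p + 1) (a :: X' ++ c :: Y') x =
        (x - a) / (q - a) * N1 + (b - x) / (b - d) * Nm :=
      bspline_succ (Lt := X' ++ c :: Y') rfl rfl rfl rfl (hdf Y') (hbl _) x
    have htail : bspline (p + 1) (X' ++ c :: (Y' ++ [e])) x =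
        (x - d) / (b - d) * Nm + (e - x) / (e - r) * N3 := by
      refine bspline_succ ?_ rfl (hdf _) (hbl _) rfl ?_ x
      · rw [show X' ++ c :: (Y' ++ [e]) = (X' ++ c :: Y') ++ [e] by simp, List.dropLast_concat]
      · rw [show X' ++ c :: (Y' ++ [e]) = (X' ++ c :: Y') ++ [e] by simp, hel]
    rw [hdl, htl, hel, firstKnot_cons, hbl, hdf, hdlast, htail]
    have hLHSd : (a :: X' ++ (Y' ++ [e])).dropLast = a :: X' ++ Y' := by
      rw [← List.append_assoc, List.dropLast_concat]
    have hLHSt : (a :: X' ++ (Y' ++ [e])).tail = X' ++ (Y' ++ [e]) := rfl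
    have hLHSe : lastKnot (a :: X' ++ (Y' ++ [e])) = e := by rw [← List.append_assoc, hel]
    -- With `X'` empty, `c` becomes the second knot and only the left term of the recursion has to
    -- be expanded by induction; `Y'` empty is the mirror case.
    by_cases hX' : X' = []
    · subst hX'
      have hY' : Y' ≠ [] := by
        rintro rfl
        simp at hl
      have hd' : d = c := rfl
      have hb' : lastKnot (a :: [] ++ Y') = b := by
        rw [lastKnot_append hY', hb, ← List.singleton_append, lastKnot_append hY']
      have hN3' : bspline p ([] ++ (Y' ++ [e])) x = N3 := rfl
      have hr' : firstKnot ([] ++ (Y' ++ [e])) = r := rfl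
      rw [bspline_succ (a := a) hLHSd hLHSt rfl hb' hr' hLHSe x, ih hX hY' hsd (by simp at hl ⊢; omega),
        hN3']
      have hlastY : lastKnot Y' = b := by
        rw [hb, ← List.singleton_append, lastKnot_append hY']
      rw [hlastY]
      change (x - a) / (b - a) * ((c - a) / (q - a) * N1 + (b - c) / (b - d) * Nm) +
        (e - x) / (e - r) * N3 = _
      have hN30 : e = c → N3 = 0 := by
        rintro rfl
        have hsY : Srt (Y' ++ [e]) := hst.infix (List.suffix_cons _ _).isInfix
        refine bspline_eq_zero (L := Y' ++ [e]) hsY (by simp at hl ⊢; omega) ?_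
        rw [hel]
        intro h
        have h5 : e ≤ firstKnot (Y' ++ [e]) :=
          (List.pairwise_cons.1 (show Srt (e :: (Y' ++ [e])) from hst)).1 _
            (firstKnot_mem (by simp))
        linarith [h.1, h.2]
      rw [hd'] at hNm0 ⊢
      by_cases hec : e = c
      · have hbc : b = c := le_antisymm (hec ▸ hbe) hcb
        rw [hN30 hec, hNm0 hbc, hec]
        ring
      · rw [div_self (sub_ne_zero.2 hec)]
        by_cases hbc : b = c
        · rw [hNm0 hbc]
          ring
        · have h1 : b - c ≠ 0 := sub_ne_zero.2 hbc
          have h2 : b - a ≠ 0 := fun h => hbc (by linarith [hae.1])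
          rw [div_self h1]
          field_simp
          ring
    · by_cases hY' : Y' = []
      · subst hY'
        have hb' : b = c := rfl
        have hq' : lastKnot (a :: X' ++ []) = q := by
          rw [hq, List.append_nil, List.dropLast_concat]
        have hN1' : bspline p (a :: X' ++ []) x = N1 := by
          rw [hN1, List.append_nil, List.dropLast_concat]
        have hd' : firstKnot (X' ++ ([] ++ [e])) = d := by
          rw [hd, firstKnot_append hX', firstKnot_append hX']
        rw [bspline_succ (a := a) hLHSd hLHSt rfl hq' hd' hLHSe x,
          ih hX' (by simp) hst (by simp at hl ⊢; omega), hN1']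
        have hdd : (X' ++ c :: ([] ++ [e])).dropLast = X' ++ c :: [] := by
          rw [show X' ++ c :: ([] ++ [e]) = (X' ++ c :: []) ++ [e] by simp, List.dropLast_concat]
        have hfX : firstKnot X' = d := by rw [hd, firstKnot_append hX']
        rw [hdd, hbl, hfX, hel []]
        change _ + (e - x) / (e - d) * ((c - d) / (b - d) * Nm + (e - c) / (e - r) * N3) = _
        have hN10 : c = a → N1 = 0 := by
          rintro rfl
          have hdc : (c :: X' ++ c :: []).dropLast = c :: X' := by rw [List.dropLast_concat]
          rw [hN1, hdc]
          have hsX : Srt (c :: X') := hsd.infix ⟨[], [c], by simp⟩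
          refine bspline_eq_zero hsX (by simp at hl ⊢; omega) ?_
          intro h
          have h5 : lastKnot (c :: X') ≤ c := by
            rw [Srt, List.pairwise_append] at hsd
            exact hsd.2.2 _ (lastKnot_mem (by simp)) c (by simp)
          rw [firstKnot_cons] at h
          linarith [h.1, h.2]
        rw [hb'] at hNm0 ⊢
        by_cases hca : c = a
        · have hcd : c = d := le_antisymm (hca ▸ had) hdc
          rw [hN10 hca, hNm0 hcd, hca]
          rw [← hca, ← hcd]
          by_cases hec : e = c
          · rw [hec]; ring
          · field_simp [sub_ne_zero.2 hec]
            ring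
        · rw [div_self (sub_ne_zero.2 hca)]
          by_cases hcd : c = d
          · rw [hNm0 hcd]
            ring
          · have h1 : c - d ≠ 0 := sub_ne_zero.2 hcd
            have h2 : e - d ≠ 0 := fun h => hcd (by linarith [hae.2])
            rw [div_self h1]
            field_simp
            ring
      · have hb' : lastKnot (a :: X' ++ Y') = b := by
          rw [lastKnot_append hY', hb, ← List.singleton_append, lastKnot_append hY']
        have hd' : firstKnot (X' ++ (Y' ++ [e])) = d := by
          rw [hd, firstKnot_append hX', firstKnot_append hX']
        have hlastY : lastKnot Y' = b := by
          rw [hb, ← List.singleton_append, lastKnot_append hY']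
        have hfX : firstKnot X' = d := by rw [hd, firstKnot_append hX']
        have hdd : (X' ++ c :: (Y' ++ [e])).dropLast = X' ++ c :: Y' := by
          rw [show X' ++ c :: (Y' ++ [e]) = (X' ++ c :: Y') ++ [e] by simp, List.dropLast_concat]
        have htt : (a :: X' ++ c :: Y').tail = X' ++ c :: Y' := rfl
        rw [bspline_succ (a := a) hLHSd hLHSt rfl hb' hd' hLHSe x,
          ih hX hY' hsd (by simp at hl ⊢; omega), ih hX' (by simp) hst (by simp at hl ⊢; omega),
          htt, hdd, hbl, hdf, hfX, hel, hlastY, firstKnot_cons]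
        change (x - a) / (b - a) * ((c - a) / (q - a) * N1 + (b - c) / (b - d) * Nm) +
          (e - x) / (e - d) * ((c - d) / (b - d) * Nm + (e - c) / (e - r) * N3) = _
        by_cases hbd : b = d
        · rw [hNm0 hbd]
          ring
        · have h1 : b - d ≠ 0 := sub_ne_zero.2 hbd
          have h2 : b - a ≠ 0 := fun h => hbd (by linarith)
          have h3 : e - d ≠ 0 := fun h => hbd (by linarith)
          -- The outer terms `N1` and `N3` agree on both sides; this is the cancellation in the
          -- coefficient of the shared spline `Nm`.
          have key : ((x - a) * (b - c) - (c - a) * (b - x)) / (b - a) +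
              ((e - x) * (c - d) - (e - c) * (x - d)) / (e - d) = 0 := by
            rw [show (x - a) * (b - c) - (c - a) * (b - x) = (x - c) * (b - a) by ring,
              show (e - x) * (c - d) - (e - c) * (x - d) = (c - x) * (e - d) by ring,
              mul_div_assoc, mul_div_assoc, div_self h2, div_self h3]
            ring
          linear_combination Nm / (b - d) * key

/-! ### Spans of B-splines -/

theorem exists_append_of_interior {L : List ℝ} {c : ℝ} (hs : Srt L) (h1 : firstKnot L < c)
    (h2 : c < lastKnot L) : ∃ X Y, X ≠ [] ∧ Y ≠ [] ∧ L = X ++ Y ∧ ins c L = X ++ c :: Y := by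
  have hne := ne_nil_of_first_lt_last (h1.trans h2)
  obtain ⟨A, D, hL, hA, hD⟩ := hs.decompose c
  set R := List.replicate (L.count c) c ++ D with hR
  have hRc : ∀ d ∈ R, c ≤ d := by
    intro d hd
    rcases List.mem_append.1 hd with hd | hd
    · rw [List.eq_of_mem_replicate hd]
    · exact (hD d hd).le
  refine ⟨A, R, ?_, ?_, hL, ?_⟩
  · intro h0
    rw [h0, List.nil_append] at hL
    exact absurd (hRc _ (hL ▸ firstKnot_mem hne)) (not_le.2 (hL ▸ h1))
  · intro h0
    rw [h0, List.append_nil] at hL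
    exact absurd (hA _ (hL ▸ lastKnot_mem hne)) (not_lt.2 (hL ▸ h2.le))
  · conv_lhs => rw [hL]
    exact ins_append (hL ▸ hs) (fun a ha => (hA a ha).le) hRc

theorem eval_update (p : Fin 2 → ℕ) (B : LocalKnots) (k : Fin 2) (W : List ℝ) (z : Fin 2 → ℝ) :
    LocalKnots.eval p (Function.update B k W) z =
      bspline (p k) W (z k) * bspline (p (1 - k)) (B (1 - k)) (z (1 - k)) := by
  fin_cases k <;> simp [LocalKnots.eval, Fin.prod_univ_two, mul_comm]

theorem eval_eq_combination {p lo hi} {B : LocalKnots} (hB : Reg p lo hi B) {k : Fin 2} {c : ℝ}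
    (h1 : firstKnot (B k) < c) (h2 : c < lastKnot (B k)) :
    ∃ α β : ℝ, B.eval p =
      α • LocalKnots.eval p (Function.update B k (ins c (B k)).dropLast) +
      β • LocalKnots.eval p (Function.update B k (ins c (B k)).tail) := by
  obtain ⟨X, Y, hX, hY, hL, hins⟩ := exists_append_of_interior (hB.srt k) h1 h2
  have hl := hB.len k
  rw [hL, List.length_append] at hl
  have hs := (hB.srt k).ins c
  rw [hins] at hs
  have key := bspline_knot_insertion hX hY hs hl
  refine ⟨(c - firstKnot X) / (lastKnot (X ++ c :: Y).dropLast - firstKnot X),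
    (lastKnot Y - c) / (lastKnot Y - firstKnot (X ++ c :: Y).tail), funext fun z => ?_⟩
  have h3 := eval_update p B k (B k) z
  rw [Function.update_eq_self] at h3
  simp only [Pi.add_apply, Pi.smul_apply, smul_eq_mul, eval_update, hins]
  rw [h3, hL, key (z k), add_mul, mul_assoc, mul_assoc]

/-- By knot insertion each replaced B-spline is a combination of its two halves, and the process
terminates because the room decreases. -/
theorem eval_mem_span_refine {p lo hi} {M : Mesh} {G : Finset ℝ} {n : ℕ} (hM : M.FinLines G n)
    {B : LocalKnots} (hB : Reg p lo hi B) {S : Set LocalKnots} (hBS : B ∈ S) :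
    B.eval p ∈ Submodule.span ℝ (LocalKnots.eval p '' refine M S) := by
  have key : ∀ B', Reg p lo hi B' → Reach M B B' →
      B'.eval p ∈ Submodule.span ℝ (LocalKnots.eval p '' refine M S) := by
    intro B' hB' hr
    induction hroom : LocalKnots.room G n B' using Nat.strong_induction_on generalizing B' with
    | _ r ih =>
      by_cases hm : MinimalSupport M B'
      · exact Submodule.subset_span ⟨B', ⟨hm, B, hBS, hr⟩, rfl⟩
      · simp only [MinimalSupport, not_forall, not_not] at hm
        obtain ⟨k, c, ht⟩ := hm
        obtain ⟨α, β, h⟩ := eval_eq_combination hB' ht.1 ht.2.1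
        have step : ∀ W, (W = (ins c (B' k)).dropLast ∨ W = (ins c (B' k)).tail) →
            LocalKnots.eval p (Function.update B' k W) ∈
              Submodule.span ℝ (LocalKnots.eval p '' refine M S) := by
          intro W hW
          have hl : W.length = (B' k).length := by
            rcases hW with rfl | rfl
            · rw [List.length_dropLast, length_ins]; rfl
            · rw [List.length_tail, length_ins]; rfl
          have hWi := (infix_ins_iff_split hl).2 hW
          exact ih _ (hroom ▸ room_update_lt hM hB' ht hWi hl) _
            (hB'.update_ins ht.1 ht.2.1 hWi hl)
            (hr.tail (splitsTo_iff.2 ⟨k, c, W, ht, hWi, hl, rfl⟩)) rfl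
        rw [h]
        exact Submodule.add_mem _ (Submodule.smul_mem _ _ (step _ (Or.inl rfl)))
          (Submodule.smul_mem _ _ (step _ (Or.inr rfl)))
  exact key B hB .refl

/-! ### B-splines between knots -/

/-- The open box with corners `l` and `r`. -/
def box (l r : Fin 2 → ℝ) : Set (Fin 2 → ℝ) := {z | ∀ k, z k ∈ Set.Ioo (l k) (r k)}

theorem isOpen_box (l r : Fin 2 → ℝ) : IsOpen (box l r) := by
  have : box l r = Set.univ.pi fun k => Set.Ioo (l k) (r k) := by
    ext z; simp [box]
  rw [this]
  exact isOpen_set_pi Set.finite_univ fun k _ => isOpen_Ioo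

open Polynomial in
theorem exists_polynomial_eq_bspline {l r : ℝ} {p : ℕ} {L : List ℝ} (hl : L.length = p + 2)
    (hL : ∀ y ∈ L, y ∉ Set.Ioo l r) :
    ∃ P : ℝ[X], P.natDegree ≤ p ∧ ∀ x ∈ Set.Ioo l r, bspline p L x = P.eval x := by
  induction p generalizing L with
  | zero =>
    obtain ⟨a, b, rfl⟩ := List.length_eq_two.1 hl
    have ha := hL a (by simp)
    have hb := hL b (by simp)
    simp only [Set.mem_Ioo, not_and, not_lt] at ha hb
    by_cases h : a ≤ l ∧ r ≤ b
    · refine ⟨1, by simp, fun x hx => ?_⟩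
      simp [bspline, firstKnot, lastKnot, h.1.trans hx.1.le, hx.2.trans_le h.2]
    · refine ⟨0, by simp, fun x hx => ?_⟩
      simp only [bspline, firstKnot, lastKnot, List.headD_cons, List.getLastD_cons,
        List.getLastD_nil, eval_zero, ite_eq_right_iff, one_ne_zero, imp_false, not_and, not_lt]
      intro hax
      by_contra hbx
      push Not at hbx
      refine h ⟨?_, ?_⟩
      · by_contra hla
        push Not at hla
        linarith [ha hla, hx.2]
      · exact hb (hx.1.trans hbx)
  | succ p ih =>
    obtain ⟨P1, h1, e1⟩ := ih (L := L.dropLast) (by rw [List.length_dropLast, hl]; rfl)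
      fun y hy => hL y (List.mem_of_mem_dropLast hy)
    obtain ⟨P2, h2, e2⟩ := ih (L := L.tail) (by rw [List.length_tail, hl]; rfl)
      fun y hy => hL y (List.mem_of_mem_tail hy)
    refine ⟨C ((lastKnot L.dropLast - firstKnot L)⁻¹) * (X - C (firstKnot L)) * P1 +
      C (-(lastKnot L - firstKnot L.tail)⁻¹) * (X - C (lastKnot L)) * P2, ?_, ?_⟩
    · have hlin : ∀ (u v : ℝ) (P : ℝ[X]), P.natDegree ≤ p →
          (C u * (X - C v) * P).natDegree ≤ p + 1 := by
        intro u v P hP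
        rw [mul_assoc]
        refine (natDegree_C_mul_le _ _).trans (natDegree_mul_le.trans ?_)
        rw [natDegree_X_sub_C]
        omega
      exact natDegree_add_le_of_degree_le (hlin _ _ _ h1) (hlin _ _ _ h2)
    · intro x hx
      rw [bspline, e1 x hx, e2 x hx]
      simp only [eval_add, eval_mul, eval_C, eval_sub, eval_X]
      ring

/-- The monomials of bidegree at most `(d, d)` on a set. -/
def monomialOn (d : ℕ) (Q : Set (Fin 2 → ℝ)) (i : Fin 2 → Fin (d + 1)) : Q → ℝ :=
  fun z => ∏ k, (z.1 k) ^ (i k : ℕ)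

/-- Without knots in the box each factor is a polynomial of degree at most `d`; the product is
expanded in monomials. -/
theorem domRestrict_eval_mem_span {d : ℕ} {l r : Fin 2 → ℝ} {B : LocalKnots}
    (hl : ∀ k, (B k).length = d + 2) (hB : ∀ k, ∀ y ∈ B k, y ∉ Set.Ioo (l k) (r k)) :
    (box l r).domRestrict (B.eval (bideg d)) ∈
      Submodule.span ℝ (Set.range (monomialOn d (box l r))) := by
  choose P hP1 hP2 using fun k => exists_polynomial_eq_bspline (hl k) (hB k)
  have : (box l r).domRestrict (B.eval (bideg d)) =
      ∑ i : Fin 2 → Fin (d + 1), (∏ k, (P k).coeff (i k)) • monomialOn d (box l r) i := by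
    funext z
    rw [Finset.sum_apply]
    simp only [Pi.smul_apply, smul_eq_mul, monomialOn, ← Finset.prod_mul_distrib]
    change B.eval (bideg d) z.1 = _
    rw [← Fintype.piFinset_univ, ← Finset.prod_univ_sum (fun _ => Finset.univ)
      (fun k (j : Fin (d + 1)) => (P k).coeff j * z.1 k ^ (j : ℕ))]
    refine Finset.prod_congr rfl fun k _ => ?_
    rw [show bideg d k = d from rfl, hP2 k _ (z.2 k),
      Polynomial.eval_eq_sum_range' (Nat.lt_succ_of_le (hP1 k)), Finset.sum_range]
  rw [this]
  exact Submodule.sum_mem _ fun i _ => Submodule.smul_mem _ _ (Submodule.subset_span ⟨i, rfl⟩)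

theorem finrank_span_monomialOn_le (d : ℕ) (Q : Set (Fin 2 → ℝ)) :
    Module.finrank ℝ (Submodule.span ℝ (Set.range (monomialOn d Q))) ≤ (d + 1) ^ 2 := by
  refine (finrank_range_le_card _).trans ?_
  simp

/-! ### Bernstein polynomials -/

theorem exists_bspline_eq_bernstein {a b : ℝ} (hab : a < b) (m n : ℕ) :
    ∃ C : ℝ, 0 < C ∧ ∀ x ∈ Set.Ioo a b,
      bspline (m + n) (List.replicate (m + 1) a ++ List.replicate (n + 1) b) x =
        C * (x - a) ^ n * (b - x) ^ m := by
  have hba : b - a ≠ 0 := by linarith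
  have hfirst : ∀ m Y, firstKnot (List.replicate (m + 1) a ++ Y) = a := fun m Y => rfl
  have hlast : ∀ n (X : List ℝ), lastKnot (X ++ List.replicate (n + 1) b) = b := fun n X => by
    rw [List.replicate_succ', ← List.append_assoc, lastKnot_append_singleton]
  have htail : ∀ m, (List.replicate (m + 1) a ++ List.replicate (n + 1) b).tail =
      List.replicate m a ++ List.replicate (n + 1) b := fun m => rfl
  have hdrop : ∀ m n, (List.replicate (m + 1) a ++ List.replicate (n + 1) b).dropLast =
      List.replicate (m + 1) a ++ List.replicate n b := fun m n => by
    rw [List.replicate_succ' (n := n), ← List.append_assoc, List.dropLast_concat]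
  -- Handles the ends `m = 0` and `n = 0` of the recursion, where one half has all its knots equal.
  have hconst : ∀ p (c x : ℝ), bspline p (List.replicate (p + 2) c) x = 0 := fun p c x => by
    refine bspline_eq_zero (by simp [List.pairwise_replicate]) (by simp) ?_
    have h1 : firstKnot (List.replicate (p + 2) c) = c := rfl
    have h2 : lastKnot (List.replicate (p + 2) c) = c := by
      rw [List.replicate_succ', lastKnot_append_singleton]
    rw [h1, h2]
    intro h; linarith [h.1, h.2]
  -- The degree is separated from `m + n`, so that the induction on it can lower either exponent.
  suffices H : ∀ p m n, m + n = p → ∃ C : ℝ, 0 < C ∧ ∀ x ∈ Set.Ioo a b,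
      bspline p (List.replicate (m + 1) a ++ List.replicate (n + 1) b) x =
        C * (x - a) ^ n * (b - x) ^ m from H _ m n rfl
  have hba' : 0 < (b - a)⁻¹ := inv_pos.2 (by linarith)
  intro p
  induction p with
  | zero =>
    intro m n h
    obtain ⟨rfl, rfl⟩ : m = 0 ∧ n = 0 := by omega
    refine ⟨1, one_pos, fun x hx => ?_⟩
    simp [bspline, firstKnot, lastKnot, hx.1.le, hx.2]
  | succ p ih =>
    intro m n h
    have hsucc : ∀ q d x, lastKnot (List.replicate (m + 1) a ++ List.replicate n b) = q →
        firstKnot (List.replicate m a ++ List.replicate (n + 1) b) = d →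
        bspline (p + 1) (List.replicate (m + 1) a ++ List.replicate (n + 1) b) x =
        (x - a) / (q - a) * bspline p (List.replicate (m + 1) a ++ List.replicate n b) x +
        (b - x) / (b - d) * bspline p (List.replicate m a ++ List.replicate (n + 1) b) x :=
      fun q d x hq hd => bspline_succ (hdrop m n) rfl (hfirst m _) hq hd (hlast n _) x
    rcases m with _ | m
    · obtain rfl : n = p + 1 := by omega
      obtain ⟨C, hC, e⟩ := ih 0 p (by omega)
      refine ⟨C * (b - a)⁻¹, mul_pos hC hba', fun x hx => ?_⟩
      rw [hsucc b b x (hlast p _) rfl, e x hx]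
      simp only [List.replicate_zero, List.nil_append, hconst]
      ring
    · rcases n with _ | n
      · obtain rfl : m = p := by omega
        obtain ⟨C, hC, e⟩ := ih m 0 (by omega)
        refine ⟨C * (b - a)⁻¹, mul_pos hC hba', fun x hx => ?_⟩
        rw [hsucc _ a x rfl (hfirst m _), e x hx]
        simp only [List.replicate_zero, List.append_nil, hconst]
        ring
      · obtain ⟨C1, hC1, e1⟩ := ih (m + 1) n (by omega)
        obtain ⟨C2, hC2, e2⟩ := ih m (n + 1) (by omega)
        refine ⟨(C1 + C2) * (b - a)⁻¹, mul_pos (add_pos hC1 hC2) hba', fun x hx => ?_⟩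
        rw [hsucc b a x (hlast n _) (hfirst m _), e1 x hx, e2 x hx]
        ring

open Polynomial in
-- Evaluation at `a` isolates the coefficient with index `0`; the rest is divisible by `X - a`, and
-- the quotient is a relation of lower degree.
theorem bernstein_coeff_eq_zero {a b : ℝ} (hab : a ≠ b) (p : ℕ) (c : ℕ → ℝ)
    (h : ∑ j ∈ Finset.range (p + 1), C (c j) * (X - C a) ^ j * (C b - X) ^ (p - j) = 0) :
    ∀ j ≤ p, c j = 0 := by
  induction p generalizing c with
  | zero =>
    intro j hj
    obtain rfl : j = 0 := by omega
    simpa using h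
  | succ p ih =>
    have hba : b - a ≠ 0 := sub_ne_zero.2 hab.symm
    have h0 : c 0 = 0 := by
      have h1 := congrArg (Polynomial.eval a) h
      rw [Finset.sum_range_succ', eval_add, eval_finsetSum] at h1
      simpa [hba] using h1
    rw [Finset.sum_range_succ', h0] at h
    have h2 : (X - C a) * ∑ j ∈ Finset.range (p + 1),
        C (c (j + 1)) * (X - C a) ^ j * (C b - X) ^ (p - j) = 0 := by
      rw [← h, Finset.mul_sum]
      simp only [map_zero, zero_mul, add_zero]
      refine Finset.sum_congr rfl fun j hj => ?_
      rw [show p + 1 - (j + 1) = p - j by omega]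
      ring
    have h3 := (mul_eq_zero.1 h2).resolve_left (X_sub_C_ne_zero a)
    have h4 := ih (fun j => c (j + 1)) h3
    intro j hj
    rcases j with _ | j
    · exact h0
    · exact h4 j (by omega)

/-- The local knot vectors of the Bernstein polynomials. -/
def bernElt (d : ℕ) (lo hi : Fin 2 → ℝ) (i : Fin 2 → Fin (d + 1)) : LocalKnots :=
  fun k => List.replicate (d - i k + 1) (lo k) ++ List.replicate (i k + 1) (hi k)

theorem bernElt_mem_bern (d : ℕ) (lo hi : Fin 2 → ℝ) (i : Fin 2 → Fin (d + 1)) :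
    bernElt d lo hi i ∈ bern (bideg d) lo hi := by
  intro k
  have hi' := (i k).2
  refine ⟨⟨List.replicate (i k) (lo k), List.replicate (d - i k) (hi k), ?_⟩, ?_⟩
  · simp only [bernElt, bernKnots, List.append_assoc, List.replicate_append_replicate]
    rw [← List.append_assoc, List.replicate_append_replicate]
    congr 2
    · simp only [bideg]; omega
    · simp only [bideg]; omega
  · simp [bernElt, bideg]; omega

/-- A relation on a subinterval of positive length is a polynomial with infinitely many roots, so it
holds identically. -/
theorem bernstein_sum_eq_zero {a b l r : ℝ} (hab : a < b) (hlr : l < r) (hal : a ≤ l) (hrb : r ≤ b)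
    {d : ℕ} (c : Fin (d + 1) → ℝ)
    (h : ∀ x ∈ Set.Ioo l r, ∑ j, c j * bspline d
      (List.replicate (d - j + 1) a ++ List.replicate (j + 1) b) x = 0) : ∀ j, c j = 0 := by
  have hex : ∀ j : Fin (d + 1), ∃ C : ℝ, 0 < C ∧ ∀ x ∈ Set.Ioo a b,
      bspline d (List.replicate (d - j + 1) a ++ List.replicate (j + 1) b) x =
        C * (x - a) ^ (j : ℕ) * (b - x) ^ (d - j) := by
    intro j
    have := exists_bspline_eq_bernstein hab (d - j) j
    rwa [show d - (j : ℕ) + j = d by omega] at this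
  choose C hC e using hex
  set P : Polynomial ℝ := ∑ j ∈ Finset.range (d + 1),
    Polynomial.C (if hj : j < d + 1 then c ⟨j, hj⟩ * C ⟨j, hj⟩ else 0) *
      (Polynomial.X - Polynomial.C a) ^ j * (Polynomial.C b - Polynomial.X) ^ (d - j) with hP
  have hP0 : P = 0 := by
    refine Polynomial.eq_zero_of_infinite_isRoot P ((Set.Ioo_infinite hlr).mono fun x hx => ?_)
    rw [Set.mem_ofPred_eq, Polynomial.IsRoot, ← h x hx, hP, Polynomial.eval_finsetSum,
      Finset.sum_range]
    refine Finset.sum_congr rfl fun j _ => ?_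
    rw [e j x ⟨hal.trans_lt hx.1, hx.2.trans_le hrb⟩]
    simp only [j.2, dif_pos, Polynomial.eval_mul, Polynomial.eval_pow, Polynomial.eval_sub,
      Polynomial.eval_C, Polynomial.eval_X, Fin.eta]
    ring
  intro j
  have := bernstein_coeff_eq_zero hab.ne d _ hP0 j (Nat.le_of_lt_succ j.2)
  simp only [j.2, dif_pos, mul_eq_zero] at this
  exact this.resolve_right (hC j).ne'

/-- Fixing the second variable, univariate independence in the first makes the inner sums vanish;
univariate independence in the second finishes. -/
theorem linearIndependent_bernElt {lo hi l r : Fin 2 → ℝ} (hlh : ∀ k, lo k < hi k)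
    (hlr : ∀ k, l k < r k) (hl : ∀ k, lo k ≤ l k) (hr : ∀ k, r k ≤ hi k) (d : ℕ) :
    LinearIndependent ℝ (fun i : Fin 2 → Fin (d + 1) =>
      (box l r).domRestrict ((bernElt d lo hi i).eval (bideg d))) := by
  rw [Fintype.linearIndependent_iff]
  intro g hg
  set φ : Fin 2 → Fin (d + 1) → ℝ → ℝ := fun k j x => bspline d
    (List.replicate (d - j + 1) (lo k) ++ List.replicate (j + 1) (hi k)) x with hφ
  have h1 : ∀ x ∈ Set.Ioo (l 0) (r 0), ∀ y ∈ Set.Ioo (l 1) (r 1),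
      ∑ i : Fin (d + 1), (∑ j : Fin (d + 1), g ![i, j] * φ 1 j y) * φ 0 i x = 0 := by
    intro x hx y hy
    have hz : (![x, y] : Fin 2 → ℝ) ∈ box l r := by
      intro k
      fin_cases k
      · exact hx
      · exact hy
    have h2 := congrFun hg ⟨_, hz⟩
    rw [Finset.sum_apply] at h2
    rw [← Equiv.sum_comp (finTwoArrowEquiv (Fin (d + 1))).symm, Fintype.sum_prod_type] at h2
    rw [← (show _ = (0 : ℝ) from h2)]
    refine Finset.sum_congr rfl fun i _ => ?_
    rw [Finset.sum_mul]
    refine Finset.sum_congr rfl fun j _ => ?_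
    change _ = g ![i, j] * LocalKnots.eval (bideg d) (bernElt d lo hi ![i, j]) ![x, y]
    rw [LocalKnots.eval, Fin.prod_univ_two]
    change _ = g ![i, j] * (φ 0 i x * φ 1 j y)
    ring
  have h2 : ∀ y ∈ Set.Ioo (l 1) (r 1), ∀ i : Fin (d + 1),
      ∑ j : Fin (d + 1), g ![i, j] * φ 1 j y = 0 := fun y hy =>
    bernstein_sum_eq_zero (hlh 0) (hlr 0) (hl 0) (hr 0) _ fun x hx => h1 x hx y hy
  intro i
  have h3 := bernstein_sum_eq_zero (hlh 1) (hlr 1) (hl 1) (hr 1) (fun j => g ![i 0, j])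
    (fun y hy => h2 y hy (i 0)) (i 1)
  rw [← h3]
  congr 1
  funext k
  fin_cases k <;> rfl

/-! ### Counting B-splines on boxes -/

/-- The B-splines of the group of `P`, enumerated. -/
def grpElt (s : ℕ) (P : LocalKnots) (i : Fin 2 → Fin (s + 1)) : LocalKnots := fun k =>
  List.replicate (s + 1 - i k) ((P k).getD 0 0) ++
    (List.replicate (s + 1) ((P k).getD 1 0) ++ List.replicate (i k + 1) ((P k).getD 2 0))

theorem grpElt_grp (s : ℕ) {P : LocalKnots} (hP : ∀ k, (P k).length = 3)
    (i : Fin 2 → Fin (s + 1)) : Grp s P (grpElt s P i) := by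
  intro k
  obtain ⟨a, b, c, h⟩ := exists_triple_of_length (hP k)
  have hi := (i k).2
  refine ⟨?_, ?_⟩
  · rw [grpElt, h]
    exact infix_infl_triple (Nat.le_of_lt_succ hi) a b c
  · simp [grpElt]; omega

theorem Grp.exists_eq_grpElt {s : ℕ} {P B : LocalKnots} (hP : ∀ k, (P k).length = 3)
    (h : Grp s P B) : ∃ i, B = grpElt s P i := by
  have hex : ∀ k, ∃ r ≤ s, B k = List.replicate (s + 1 - r) ((P k).getD 0 0) ++
      (List.replicate (s + 1) ((P k).getD 1 0) ++ List.replicate (r + 1) ((P k).getD 2 0)) := by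
    intro k
    obtain ⟨a, b, c, habc⟩ := exists_triple_of_length (hP k)
    have h1 := (h k).1
    rw [habc] at h1 ⊢
    exact window_infl_triple h1 (h k).2
  choose r hr h using hex
  exact ⟨fun k => ⟨r k, Nat.lt_succ_of_le (hr k)⟩, funext h⟩

theorem triple_window_inj {s r r' : ℕ} (hr : r ≤ s) (hr' : r' ≤ s) {a b c a' b' c' : ℝ}
    (hac : a < c)
    (h : List.replicate (s + 1 - r) a ++ (List.replicate (s + 1) b ++ List.replicate (r + 1) c) =
      List.replicate (s + 1 - r') a' ++
        (List.replicate (s + 1) b' ++ List.replicate (r' + 1) c')) :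
    a = a' ∧ b = b' ∧ c = c' ∧ r = r' := by
  have ha : a = a' := by
    have := congrArg (fun L => L[0]?) h
    simpa [List.getElem?_append, List.getElem?_replicate, show r < s + 1 by omega,
      show r' < s + 1 by omega] using this
  -- Position `s + 1` belongs to the middle block for every offset `r ≤ s`.
  have hb : b = b' := by
    have := congrArg (fun L => L[s + 1]?) h
    simpa [List.getElem?_append, List.getElem?_replicate,
      show ¬ (s + 1 < s + 1 - r) by omega, show ¬ (s + 1 < s + 1 - r') by omega,
      show s + 1 - (s + 1 - r) < s + 1 by omega,
      show s + 1 - (s + 1 - r') < s + 1 by omega] using this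
  have hc : c = c' := by
    have := congrArg lastKnot h
    simpa only [List.replicate_succ' (n := r), List.replicate_succ' (n := r'),
      ← List.append_assoc, lastKnot_append_singleton] using this
  subst ha hb hc
  refine ⟨rfl, rfl, rfl, ?_⟩
  -- The offset is read off from the count of an outer knot different from `b`.
  by_cases hbc : b = c
  · subst hbc
    have := congrArg (List.count a) h
    simp [List.count_replicate, hac.ne'] at this
    omega
  · have := congrArg (List.count c) h
    simp [List.count_replicate, hac.ne, hbc] at this
    omega

theorem grpElt_injective {s : ℕ} {lo hi} {P P' : LocalKnots} (hP : Reg (bideg 1) lo hi P)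
    (hP' : Reg (bideg 1) lo hi P') {i i' : Fin 2 → Fin (s + 1)}
    (h : grpElt s P i = grpElt s P' i') : P = P' ∧ i = i' := by
  have key : ∀ k, P k = P' k ∧ i k = i' k := by
    intro k
    have hk := congrFun h k
    obtain ⟨a, b, c, habc⟩ := exists_triple_of_length (hP.len k)
    obtain ⟨a', b', c', habc'⟩ := exists_triple_of_length (hP'.len k)
    have hlt := hP.lt k
    simp only [grpElt] at hk
    rw [habc, habc'] at hk
    rw [habc] at hlt
    obtain ⟨rfl, rfl, rfl, h4⟩ := triple_window_inj (Nat.le_of_lt_succ (i k).2)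
      (Nat.le_of_lt_succ (i' k).2) (show a < c from hlt) hk
    exact ⟨habc.trans habc'.symm, Fin.ext h4⟩
  exact ⟨funext fun k => (key k).1, funext fun k => (key k).2⟩

/-- The support of `B` contains the box with corners `l` and `r`. -/
def Covers (l r : Fin 2 → ℝ) (B : LocalKnots) : Prop :=
  ∀ k, firstKnot (B k) ≤ l k ∧ r k ≤ lastKnot (B k)

/-- No knot of `B` lies inside the box with corners `l` and `r`. -/
def KnotFree (l r : Fin 2 → ℝ) (B : LocalKnots) : Prop :=
  ∀ k, ∀ y ∈ B k, y ∉ Set.Ioo (l k) (r k)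

theorem eval_ne_zero_of_covers {p lo hi} {B : LocalKnots} (hB : Reg p lo hi B) {l r : Fin 2 → ℝ}
    (hf : KnotFree l r B) (hc : Covers l r B) {z : Fin 2 → ℝ} (hz : z ∈ box l r) :
    B.eval p z ≠ 0 := by
  refine Finset.prod_ne_zero_iff.2 fun k _ => ne_of_gt ?_
  exact bspline_pos (hB.srt k) (hB.len k) (fun h => hf k _ h (hz k))
    ((hc k).1.trans_lt (hz k).1) ((hz k).2.trans_le (hc k).2)

theorem first_le_and_lt_last_of_eval_ne_zero {p lo hi} {B : LocalKnots} (hB : Reg p lo hi B)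
    {z : Fin 2 → ℝ} (hz : B.eval p z ≠ 0) (k : Fin 2) :
    firstKnot (B k) ≤ z k ∧ z k < lastKnot (B k) := by
  by_contra h
  exact Finset.prod_ne_zero_iff.1 hz k (Finset.mem_univ _)
    (bspline_eq_zero (hB.srt k) (hB.len k) h)

/-- The end knots of `B` are not inside the box, so a support that meets the box contains it. -/
theorem covers_of_eval_ne_zero {p lo hi} {B : LocalKnots} (hB : Reg p lo hi B) {l r : Fin 2 → ℝ}
    (hf : KnotFree l r B) {z : Fin 2 → ℝ} (hz : z ∈ box l r) (h : B.eval p z ≠ 0) :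
    Covers l r B := by
  intro k
  obtain ⟨h1, h2⟩ := first_le_and_lt_last_of_eval_ne_zero hB h k
  have hne := ne_nil_of_first_lt_last (hB.lt k)
  constructor
  · by_contra h3
    exact hf k _ (firstKnot_mem hne) ⟨not_le.1 h3, h1.trans_lt (hz k).2⟩
  · by_contra h3
    exact hf k _ (lastKnot_mem hne) ⟨(hz k).1.trans h2, not_le.1 h3⟩

theorem Grp.covers_iff {s : ℕ} {lo hi} {P B : LocalKnots} (hP : Reg (bideg 1) lo hi P)
    (h : Grp s P B) {l r : Fin 2 → ℝ} : Covers l r B ↔ Covers l r P := by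
  unfold Covers
  simp only [(h.first_last hP _).1, (h.first_last hP _).2]

theorem Grp.knotFree {s : ℕ} {P B : LocalKnots} (h : Grp s P B) {l r : Fin 2 → ℝ}
    (hP : KnotFree l r P) : KnotFree l r B :=
  fun k y hy => hP k y (mem_infl.1 ((h k).1.subset hy))

/-- Local linear independence for one bidegree bounds the number of bilinear B-splines on
a box. -/
theorem card_covers_le {s : ℕ} {lo hi l r : Fin 2 → ℝ} (hlr : ∀ k, l k < r k)
    {T : Set LocalKnots} (hT : ∀ P ∈ T, Reg (bideg 1) lo hi P ∧ KnotFree l r P ∧ Covers l r P)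
    {S : Set LocalKnots} (hTS : ∀ P ∈ T, ∀ B, Grp s P B → B ∈ S) {Ω : Set (Fin 2 → ℝ)}
    (hΩ : box l r ⊆ Ω) (hS : LocallyLinearIndependent (bideg (2 * s + 1)) Ω S) :
    T.Finite ∧ T.ncard ≤ 4 := by
  have hLI := hS (box l r) (isOpen_box l r) hΩ
  have hgrp : ∀ (P : T) (i : Fin 2 → Fin (s + 1)), Grp s P.1 (grpElt s P.1 i) := fun P i =>
    grpElt_grp s (hT P.1 P.2).1.len i
  have hz : (fun k => (l k + r k) / 2) ∈ box l r := fun k => by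
    have := hlr k
    constructor <;> simp only <;> linarith
  let f : T × (Fin 2 → Fin (s + 1)) →
      {B : LocalKnots // B ∈ S ∧ ∃ z ∈ box l r, B.eval (bideg (2 * s + 1)) z ≠ 0} := fun x =>
    ⟨grpElt s x.1.1 x.2, hTS _ x.1.2 _ (hgrp x.1 x.2), _, hz, by
      obtain ⟨h1, h2, h3⟩ := hT x.1.1 x.1.2
      have hg := hgrp x.1 x.2
      exact eval_ne_zero_of_covers (hg.reg h1) (hg.knotFree h2) ((hg.covers_iff h1).2 h3) hz⟩
  have hf : Function.Injective f := by
    rintro ⟨P, i⟩ ⟨P', i'⟩ h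
    obtain ⟨h1, h2⟩ := grpElt_injective (hT P.1 P.2).1 (hT P'.1 P'.2).1 (congrArg Subtype.val h)
    exact Prod.ext (Subtype.ext h1) h2
  have hLI' := hLI.comp f hf
  set W := Submodule.span ℝ (Set.range (monomialOn (2 * s + 1) (box l r)))
  have hW : ∀ x, (box l r).domRestrict ((f x).1.eval (bideg (2 * s + 1))) ∈ W := fun x =>
    domRestrict_eval_mem_span (fun k => (hgrp x.1 x.2 k).2)
      ((hgrp x.1 x.2).knotFree (hT x.1.1 x.1.2).2.1)
  have hLIW : LinearIndependent ℝ (fun x => (⟨_, hW x⟩ : W)) :=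
    LinearIndependent.of_comp W.subtype hLI'
  have hWfin : Module.Finite ℝ W := Module.Finite.span_of_finite ℝ (Set.finite_range _)
  have hfin : Finite (T × (Fin 2 → Fin (s + 1))) := hLIW.finite
  have hTfin : Finite T := Finite.prod_left (Fin 2 → Fin (s + 1))
  have := Fintype.ofFinite T
  -- Here `N (s + 1) ^ 2 ≤ (2s + 2) ^ 2` for the number `N` of elements of `T`; cancelling `(s + 1)
  -- ^ 2` leaves `N ≤ 4`.
  have hcard := hLIW.fintype_card_le_finrank.trans
    (finrank_span_monomialOn_le (2 * s + 1) (box l r))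
  refine ⟨hTfin, ?_⟩
  rw [Fintype.card_prod, Fintype.card_fun, Fintype.card_fin, Fintype.card_fin,
    show 2 * s + 1 + 1 = 2 * (s + 1) by ring, mul_pow] at hcard
  rw [← Nat.card_coe_set_eq, Nat.card_eq_fintype_card]
  exact Nat.le_of_mul_le_mul_right hcard (by positivity)

/-- If at most four bilinear B-splines cover a box, then the corresponding B-splines
of higher bidegree are linearly independent on the box. -/
theorem linearIndependent_on_box {s : ℕ} {M : Mesh} {G : Finset ℝ} {n : ℕ} (hM : M.FinLines G n)
    {l r : Fin 2 → ℝ} (hlr : ∀ k, l k < r k) (hl : ∀ k, M.lo k ≤ l k) (hr : ∀ k, r k ≤ M.hi k)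
    {T : Set LocalKnots} (hTfin : T.Finite) (hTcard : T.ncard ≤ 4)
    (hTlen : ∀ P ∈ T, ∀ k, (P k).length = 3)
    {S : Set LocalKnots} (hS : S = refine M (bern (bideg (2 * s + 1)) M.lo M.hi))
    (hST : ∀ B ∈ S, (∃ z ∈ box l r, B.eval (bideg (2 * s + 1)) z ≠ 0) → ∃ P ∈ T, Grp s P B)
    {I : Set LocalKnots}
    (hI : I = {B | B ∈ S ∧ ∃ z ∈ box l r, B.eval (bideg (2 * s + 1)) z ≠ 0}) :
    LinearIndependent ℝ (fun B : I => (box l r).domRestrict (B.1.eval (bideg (2 * s + 1)))) := by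
  set d := 2 * s + 1 with hd
  have hTf : Finite T := hTfin
  let g : T × (Fin 2 → Fin (s + 1)) → LocalKnots := fun x => grpElt s x.1.1 x.2
  have hIsub : I ⊆ Set.range g := by
    rw [hI]
    rintro B ⟨hB, hz⟩
    obtain ⟨P, hP, hg⟩ := hST B hB hz
    obtain ⟨i, hi⟩ := hg.exists_eq_grpElt (hTlen P hP)
    exact ⟨⟨⟨P, hP⟩, i⟩, hi.symm⟩
  have hIfin : I.Finite := (Set.finite_range g).subset hIsub
  have hIcard : I.ncard ≤ (d + 1) ^ 2 := by
    refine (Set.ncard_le_ncard hIsub (Set.finite_range g)).trans ?_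
    rw [← Set.image_univ]
    refine (Set.ncard_image_le Set.finite_univ).trans ?_
    rw [Set.ncard_univ, Nat.card_prod, Nat.card_coe_set_eq, Nat.card_eq_fintype_card (α := _ → _),
      Fintype.card_fun, Fintype.card_fin, Fintype.card_fin, hd,
      show 2 * s + 1 + 1 = 2 * (s + 1) by ring, mul_pow]
    exact Nat.mul_le_mul_right _ hTcard
  have : Fintype I := hIfin.fintype
  -- A finite family is independent as soon as its span has rank at least its size. The size is at
  -- most `(d + 1) ^ 2`, and the Bernstein polynomials in the span supply that rank.
  rw [linearIndependent_iff_card_le_finrank_span, ← Nat.card_eq_fintype_card, Nat.card_coe_set_eq]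
  refine hIcard.trans ?_
  set W := Submodule.span ℝ (Set.range fun B : I => (box l r).domRestrict (B.1.eval (bideg d)))
    with hW
  have hWfin : Module.Finite ℝ W := Module.Finite.span_of_finite ℝ (Set.finite_range _)
  let ρ : ((Fin 2 → ℝ) → ℝ) →ₗ[ℝ] (box l r → ℝ) := LinearMap.funLeft ℝ ℝ Subtype.val
  have hρ : ∀ f, ρ f = (box l r).domRestrict f := fun f => rfl
  have hspan : Submodule.span ℝ (LocalKnots.eval (bideg d) '' S) ≤ W.comap ρ := by
    rw [Submodule.span_le]
    rintro _ ⟨B, hB, rfl⟩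
    change ρ (B.eval (bideg d)) ∈ W
    by_cases hz : ∃ z ∈ box l r, B.eval (bideg d) z ≠ 0
    · have hBI : B ∈ I := by rw [hI]; exact ⟨hB, hz⟩
      exact Submodule.subset_span ⟨⟨B, hBI⟩, rfl⟩
    · push Not at hz
      have : ρ (B.eval (bideg d)) = 0 := funext fun z => hz z.1 z.2
      rw [this]
      exact W.zero_mem
  have hbern : ∀ i, (box l r).domRestrict ((bernElt d M.lo M.hi i).eval (bideg d)) ∈ W := by
    intro i
    have h1 := bernElt_mem_bern d M.lo M.hi i
    have h2 := eval_mem_span_refine hM (reg_of_mem_bern M.lo_lt_hi h1) h1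
    rw [← hS] at h2
    exact hspan h2
  have hLI : LinearIndependent ℝ (fun i => (⟨_, hbern i⟩ : W)) :=
    LinearIndependent.of_comp W.subtype (linearIndependent_bernElt M.lo_lt_hi hlr hl hr d)
  have := hLI.fintype_card_le_finrank
  change _ ≤ Module.finrank ℝ W
  simpa using this

/-- All knots ever inserted lie on meshlines, so one finite set contains the knots of all refined
B-splines and a small box can avoid them simultaneously. -/
theorem knot_mem_of_reach {p lo hi} {M : Mesh} {G : Finset ℝ} {n : ℕ} (hM : M.FinLines G n)
    {H : Finset ℝ} (hGH : G ⊆ H) {B B' : LocalKnots} (hB : Reg p lo hi B)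
    (hBH : ∀ k, ∀ y ∈ B k, y ∈ H) (h : Reach M B B') : ∀ k, ∀ y ∈ B' k, y ∈ H := by
  induction h with
  | refl => exact hBH
  | @tail B1 B2 hr hstep ih =>
    have hreg := Reach.reg hB hr
    obtain ⟨k, c, W, ht, hW, -, rfl⟩ := splitsTo_iff.1 hstep
    intro k' y hy
    by_cases hk : k' = k
    · subst hk
      rw [Function.update_self] at hy
      rcases mem_ins.1 (hW.subset hy) with rfl | hy
      · have h3 := ht.2.2 _ (hreg.firstKnot_mem_supp _)
        exact hGH ((hM k' y _).2 (Nat.ne_of_gt (Nat.zero_lt_of_lt h3)))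
      · exact ih k' y hy
    · rw [Function.update_of_ne hk] at hy
      exact ih k' y hy

open Filter Topology in
/-- To the upper right of every point of an open set, there is a box without knots. -/
theorem exists_knotFree_box {U : Set (Fin 2 → ℝ)} (hU : IsOpen U) {z : Fin 2 → ℝ} (hz : z ∈ U)
    (H : Finset ℝ) : ∃ δ > 0, box z (fun k => z k + δ) ⊆ U ∧
      ∀ y ∈ H, ∀ k, y ∉ Set.Ioo (z k) (z k + δ) := by
  obtain ⟨ε, hε, hball⟩ := Metric.isOpen_iff.1 hU z hz
  have h1 : ∀ᶠ δ in 𝓝[>] (0 : ℝ), ∀ y ∈ H, ∀ k : Fin 2, y ∉ Set.Ioo (z k) (z k + δ) := by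
    rw [Filter.eventually_all_finset]
    intro y _
    rw [Filter.eventually_all]
    intro k
    by_cases hy : y ≤ z k
    · exact Filter.Eventually.of_forall fun δ h => absurd h.1 (not_lt.2 hy)
    · have : 0 < y - z k := by linarith
      filter_upwards [Ioo_mem_nhdsGT this] with δ hδ h
      linarith [h.2, hδ.2]
  obtain ⟨δ, hδ, hδ'⟩ := (h1.and (Ioo_mem_nhdsGT hε)).exists
  refine ⟨δ, hδ'.1, fun w hw => hball ?_, hδ⟩
  rw [Metric.mem_ball, dist_pi_lt_iff hε]
  intro k
  have := hw k
  rw [Real.dist_eq, abs_lt]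
  constructor <;> linarith [this.1, this.2, hδ'.2]

/-- A coefficient of a relation on `U` can be tested on a small knot-free box next to a point where
its B-spline is nonzero. There the bound by four, obtained from `s`, gives independence for `s'`. -/
theorem locallyLinearIndependent_setMult {s s' : ℕ} {M : Mesh} {G : Finset ℝ} {n : ℕ}
    (hM : M.FinLines G n)
    (hS : LocallyLinearIndependent (bideg (2 * s + 1)) M.domain
      (refine (M.setMult (s + 1) (2 * s + 2)) (bern (bideg (2 * s + 1)) M.lo M.hi))) :
    LocallyLinearIndependent (bideg (2 * s' + 1)) M.domain
      (refine (M.setMult (s' + 1) (2 * s' + 2)) (bern (bideg (2 * s' + 1)) M.lo M.hi)) := by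
  set S := refine (M.setMult (s + 1) (2 * s + 2)) (bern (bideg (2 * s + 1)) M.lo M.hi)
  set M' := M.setMult (s' + 1) (2 * s' + 2) with hM'
  set S' := refine M' (bern (bideg (2 * s' + 1)) M.lo M.hi) with hS'
  set S1 := refine (M.setMult 1 2) (bern (bideg 1) M.lo M.hi) with hS1
  set H : Finset ℝ := G ∪ {M.lo 0, M.lo 1, M.hi 0, M.hi 1}
  have hS1reg : ∀ P ∈ S1, Reg (bideg 1) M.lo M.hi P := fun P ⟨_, _, hP0, hr⟩ =>
    Reach.reg (reg_of_mem_bern M.lo_lt_hi hP0) hr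
  have hS1knots : ∀ P ∈ S1, ∀ k, ∀ y ∈ P k, y ∈ H := by
    rintro P ⟨_, P0, hP0, hr⟩
    refine knot_mem_of_reach (hM.setMult 1 2) Finset.subset_union_left
      (reg_of_mem_bern M.lo_lt_hi hP0) (fun k y hy => ?_) hr
    have := (hP0 k).1.subset hy
    simp only [bernKnots, List.mem_append, List.mem_replicate] at this
    fin_cases k <;> rcases this with h | h <;> simp [h.2]
  intro U hU hUΩ
  rw [linearIndependent_iff']
  intro t g hg i hi
  obtain ⟨B0, hB0, z, hz, hBz⟩ := i
  -- B-splines are supported on half-open intervals, closed on the left, so a B-spline nonzero at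
  -- `z` covers a small box to the upper right of `z`, even if `z` lies on a meshline.
  obtain ⟨δ, hδ, hsub, hfree⟩ := exists_knotFree_box hU hz H
  set r : Fin 2 → ℝ := fun k => z k + δ with hr
  have hlr : ∀ k, z k < r k := fun k => by simp [hr, hδ]
  have hS1free : ∀ P ∈ S1, KnotFree z r P := fun P hP k y hy => hfree y (hS1knots P hP k y hy) k
  have hS'grp : ∀ B ∈ S', ∃ P ∈ S1, Grp s' P B := fun B hB => (mem_refine_iff_grp s' hM B).1 hB
  have hcov0 : Covers z r B0 := by
    obtain ⟨P, hP, hg⟩ := hS'grp B0 hB0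
    have hreg := hg.reg (hS1reg P hP)
    intro k
    obtain ⟨h1, h2⟩ := first_le_and_lt_last_of_eval_ne_zero hreg hBz k
    refine ⟨h1, ?_⟩
    by_contra h3
    exact hg.knotFree (hS1free P hP) k _ (lastKnot_mem (ne_nil_of_first_lt_last (hreg.lt k)))
      ⟨h2, not_le.1 h3⟩
  have hreg0 : Reg (bideg (2 * s' + 1)) M.lo M.hi B0 :=
    let ⟨P, hP, hg⟩ := hS'grp B0 hB0; hg.reg (hS1reg P hP)
  have hfree0 : KnotFree z r B0 :=
    let ⟨P, hP, hg⟩ := hS'grp B0 hB0; hg.knotFree (hS1free P hP)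
  have hl : ∀ k, M.lo k ≤ z k := fun k => (hreg0.lo_le k).trans (hcov0 k).1
  have hr' : ∀ k, r k ≤ M.hi k := fun k => (hcov0 k).2.trans (hreg0.le_hi k)
  set T := {P | P ∈ S1 ∧ Covers z r P} with hT
  obtain ⟨hTfin, hTcard⟩ := card_covers_le (s := s) (T := T) (S := S) hlr
    (fun P hP => ⟨hS1reg P hP.1, hS1free P hP.1, hP.2⟩)
    (fun P hP B hB => (mem_refine_iff_grp s hM B).2 ⟨P, hP.1, hB⟩) (hsub.trans hUΩ) hS
  have hLI := linearIndependent_on_box (s := s') (M := M') (hM.setMult _ _) (l := z) (r := r)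
    hlr hl hr' hTfin hTcard (fun P hP => (hS1reg P hP.1).len) hS'
    (fun B hB ⟨w, hw, hBw⟩ => by
      obtain ⟨P, hP, hg⟩ := hS'grp B hB
      have h1 := hS1reg P hP
      exact ⟨P, ⟨hP, (hg.covers_iff h1).1 (covers_of_eval_ne_zero (hg.reg h1)
        (hg.knotFree (hS1free P hP)) hw hBw)⟩, hg⟩) rfl
  have hmid : (fun k => (z k + r k) / 2) ∈ box z r := fun k => by
    have := hlr k
    constructor <;> simp only <;> linarith
  have hB0I : B0 ∈ {B | B ∈ S' ∧ ∃ w ∈ box z r, B.eval (bideg (2 * s' + 1)) w ≠ 0} :=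
    ⟨hB0, _, hmid, eval_ne_zero_of_covers hreg0 hfree0 hcov0 hmid⟩
  classical
  have hLIon : LinearIndepOn ℝ (fun B : LocalKnots =>
      (box z r).domRestrict (B.eval (bideg (2 * s' + 1))))
      {B | B ∈ S' ∧ ∃ w ∈ box z r, B.eval (bideg (2 * s' + 1)) w ≠ 0} := hLI
  rw [linearIndepOn_iff'] at hLIon
  -- The relation is restricted to the box; the B-splines vanishing there drop out of the sum, and
  -- `B0` is not among them.
  have key := hLIon ((t.image Subtype.val).filter
      fun B => ∃ w ∈ box z r, B.eval (bideg (2 * s' + 1)) w ≠ 0)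
    (fun B => if h : B ∈ S' ∧ ∃ w ∈ U, B.eval (bideg (2 * s' + 1)) w ≠ 0 then g ⟨B, h⟩ else 0)
    (by
      intro B hB
      simp only [Finset.coe_filter, Finset.mem_image] at hB
      obtain ⟨⟨⟨B', h'⟩, -, rfl⟩, h⟩ := hB
      exact ⟨h'.1, h⟩)
    (by
      rw [Finset.sum_filter_of_ne]
      · rw [Finset.sum_image Subtype.val_injective.injOn]
        funext w
        have h1 := congrFun hg ⟨w.1, hsub w.2⟩
        rw [Finset.sum_apply] at h1 ⊢
        refine Eq.trans (Finset.sum_congr rfl fun B _ => ?_) h1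
        rw [dif_pos B.2]
        rfl
      · intro B _ hne
        by_contra hcon
        push Not at hcon
        refine hne ?_
        have : (box z r).domRestrict (B.eval (bideg (2 * s' + 1))) = 0 :=
          funext fun w => hcon w.1 w.2
        rw [this, smul_zero])
    B0 (by
      simp only [Finset.mem_filter, Finset.mem_image]
      exact ⟨⟨_, hi, rfl⟩, hB0I.2⟩)
  rw [dif_pos ⟨hB0, z, hz, hBz⟩] at key
  exact key

end LRSpline

end

/-! ### Admissibility for the new bidegree -/

theorem corollary1 (s s' : ℕ) (M : LRSpline.Mesh) (hM : LRSpline.AdmissibleRM s M) :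
    LRSpline.AdmissibleRM s' (M.setMult (s' + 1) (2 * s' + 2)) := by
  obtain ⟨S, hS⟩ := hM.isLR
  obtain ⟨G, n, hG⟩ := hS.exists_finLines
  have hMeq := hM.setMult_eq
  refine ⟨hS.setMult s' fun k c t => ?_, fun k c hc t hne => ?_, fun k c hc t ht => ?_,
    fun S' hS' => ?_⟩
  -- Admissibility says that resetting the multiplicities to those for `s` changes nothing, so the
  -- bound `MultLE` holds with equality.
  · rw [hMeq]
  · rw [M.setMult_mult_interior _ _ hc] at hne ⊢
    split_ifs at hne ⊢
    · exact absurd rfl hne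
    · rfl
  · rw [M.setMult_mult, if_neg]
    · exact if_pos hc
    rw [hM.boundary k c hc t ht]
    omega
  -- For both bidegrees the collection of LR B-splines is the refinement of the Bernstein basis
  -- along the mesh, whatever the construction.
  · have hLLI := hM.locallyLinearIndependent S hS
    rw [hS.eq_refine] at hLLI
    rw [hS'.eq_refine]
    refine LRSpline.locallyLinearIndependent_setMult (s := s) hG ?_
    rw [hMeq]
    exact hLLI
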